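/- Let $\epsilon=1/100$ and $\eta>40$. Let $H$ be a holomorphic function on the strip $|\mathrm{Re}\,\mu|<2\eta$ with $H(-\mu)=H(\mu)$ and $H(\mu)\ll e^{-2\pi|\mu|}$ there. Let $\alpha_1,\alpha_2,\alpha_3\in\mathbb{C}$ be distinct, with $\alpha_1+\alpha_2+\alpha_3=0$ and $|\alpha_1|,|\alpha_2|<\epsilon/1000$. Let $\Lambda(s)=\pi^{-s/2}\Gamma(s/2)\zeta(s)$ be the completed Riemann zeta function, and put $$(\mathcal{C}_\alpha H)(s)=\int_{(0)}H(\mu)\,\frac{\prod_{i=1}^{3}\Lambda(s+\mu-\alpha_i)\Lambda(s-\mu-\alpha_i)}{\Lambda(1+2\mu)\Lambda(1-2\mu)}\,\frac{d\mu}{2\pi i},$$ the integral being taken upwards along the line $\mathrm{Re}\,\mu=0$, and $$(\mathcal{R}_\alpha H)(s)=2\sum_{i=1}^{3}H(1-s+\alpha_i)\,\frac{\prod_{1\le j\le 3,\ j\ne i}\Lambda(1+\alpha_i-\alpha_j)\,\Lambda(2s-1-\alpha_i-\alpha_j)}{\Lambda(3-2s+2\alpha_i)}.$$ The integral $(\mathcal{C}_\alpha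 H)(s)$ converges absolutely both for $\mathrm{Re}\,s>1+\max_i\mathrm{Re}\,\alpha_i$ and for $\epsilon<\mathrm{Re}\,s<1-\epsilon$. The function $s\mapsto(\mathcal{C}_\alpha H)(s)$, which is holomorphic on $\mathrm{Re}\,s>1+\max_i\mathrm{Re}\,\alpha_i$, has a meromorphic continuation from that half-plane to the half-plane $\mathrm{Re}\,s>\epsilon$. On the strip $\epsilon<\mathrm{Re}\,s<1-\epsilon$ this continuation is equal to $(\mathcal{R}_\alpha H)(s)+(\mathcal{C}_\alpha H)(s)$, with $(\mathcal{C}_\alpha H)(s)$ still given by the integral above, for every $s$ other than the possible poles $s=(1-\alpha_k)/2$, $k=1,2,3$. -/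

import Mathlib

/-- The class of test functions on the strip `|Re μ| < 2η`: holomorphic, even, and of size
`O(exp (-2π|μ|))` on the whole strip. -/
structure IsTestFunction (η : ℝ) (H : ℂ → ℂ) : Prop where
  holomorphic : DifferentiableOn ℂ H {μ : ℂ | |μ.re| < 2 * η}
  even : ∀ μ : ℂ, |μ.re| < 2 * η → H (-μ) = H μ
  decay : ∃ C : ℝ, ∀ μ : ℂ, |μ.re| < 2 * η → ‖H μ‖ ≤ C * Real.exp (-(2 * Real.pi * ‖μ‖))

/-- The integrand of the continuous spectrum. Mathlib's `completedRiemannZeta` is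
`Λ(s) = π^(-s/2) Γ(s/2) ζ(s)`. -/
noncomputable def contIntegrand (α : Fin 3 → ℂ) (H : ℂ → ℂ) (s μ : ℂ) : ℂ :=
  H μ * (∏ i : Fin 3, completedRiemannZeta (s + μ - α i) * completedRiemannZeta (s - μ - α i)) /
    (completedRiemannZeta (1 + 2 * μ) * completedRiemannZeta (1 - 2 * μ))

/-- The integral of `contIntegrand` along the line `Re μ = 0`, upwards, against `dμ / (2πi)`,
with `μ = i t` and `dμ = i dt`. -/
noncomputable def contSpectrum (α : Fin 3 → ℂ) (H : ℂ → ℂ) (s : ℂ) : ℂ :=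
  (1 / (2 * (Real.pi : ℂ) * Complex.I)) *
    ∫ t : ℝ, contIntegrand α H s ((t : ℂ) * Complex.I) * Complex.I

/-- The residual term. -/
noncomputable def residualTerm (α : Fin 3 → ℂ) (H : ℂ → ℂ) (s : ℂ) : ℂ :=
  2 * ∑ i : Fin 3, H (1 - s + α i) *
    (∏ j ∈ Finset.univ.erase i,
      completedRiemannZeta (1 + α i - α j) * completedRiemannZeta (2 * s - 1 - α i - α j)) /
    completedRiemannZeta (3 - 2 * s + 2 * α i)

/-- `F` is a meromorphic continuation to the domain `U` of the holomorphic function `f` on the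
nonempty open subset `V` of `U`. -/
structure IsMeromorphicContinuation (f : ℂ → ℂ) (V : Set ℂ) (F : ℂ → ℂ) (U : Set ℂ) : Prop where
  isOpen_source : IsOpen V
  nonempty_source : V.Nonempty
  isOpen_target : IsOpen U
  isPreconnected_target : IsPreconnected U
  subset : V ⊆ U
  holomorphic : DifferentiableOn ℂ f V
  meromorphic : MeromorphicOn F U
  eqOn : Set.EqOn F f V

open Filter Topology MeasureTheory

/-! No contour is moved; the integral stays on `Re μ = 0` and the jump across each polar line is
computed. Put `μ = it` and `p_i = s - 1 - α i`. For `Re s > ε` the arguments of the six zeta factors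
in the numerator avoid the pole of `Λ` at `0`. Replacing `Λ(z)` by `(z - 1) Λ(z)` turns the
integrand into `K(s, it) / ∏ (p_i² + t²)`, where `K` is even in `μ` and regular on the line
(`regularKernel`). Partial fractions in `t²` split this into three integrals of `K(s, it) / (p_i² +
t²)`, valid off a discrete set of `s` because the `α i` are distinct (`contSpectrum_eq_sum`).

Each such integral is holomorphic off `Re p_i = 0`. Subtracting `K(s, p_i)` from the numerator makes
it vanish at `it = ±p_i`, so the regularized integral is holomorphic across that line
(`analyticAt_integral_sub_div_sq_add_sq`). What was subtracted is `K(s, p_i) ∫ dt / (p_i² + t²)`,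
which equals `±π K(s, p_i) / p_i` with the sign of `Re p_i`. The continuation to the left is
therefore the same integral plus `2π K(s, p_i) / p_i`; with the partial fraction coefficient and the
factor `1 / 2π` this is the `i`-th residual summand (`residualSummand_eq`,
`meromorphicAt_crossTerm`).

Convergence needs a lower bound for `Λ(1 ± 2it)`. The 3-4-1 inequality bounds `ζ(1 + iy)` below by a
multiple of `|y|⁻⁴`, so with the size of Gamma the reciprocal of the denominator is `O((1 + |t|)⁸
e^{π|t|})`. The decay `e^{-2π|t|}` of `H` absorbs this and the polynomial growth of the numerator.
-/

/-! ### Polynomial lower bound for zeta on the line Re s = 1 -/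

lemma integrableOn_fract_mul_cpow {s : ℂ} (hs : 1 ≤ s.re) :
    IntegrableOn (fun t : ℝ => ((Int.fract t : ℝ) : ℂ) * (t : ℂ) ^ (-(s + 1))) (Set.Ioi 1) := by
  have h0 : IntegrableOn (fun t : ℝ => (t : ℂ) ^ (-(s + 1))) (Set.Ioi 1) :=
    integrableOn_Ioi_cpow_of_lt (by simp; linarith) zero_lt_one
  refine Integrable.bdd_mul (c := 1) h0
    (Complex.measurable_ofReal.comp measurable_fract).aestronglyMeasurable ?_
  refine Eventually.of_forall fun t => ?_
  rw [Complex.norm_real, Real.norm_of_nonneg (Int.fract_nonneg t)]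
  exact (Int.fract_lt_one t).le

/-- Abel summation, with `⌊t⌋ = t - fract t`. The pole is isolated in `s / (s - 1)`, and the
remaining integral is controlled uniformly up to `Re s = 1`. -/
lemma riemannZeta_eq_sub_integral_fract {s : ℂ} (hs : 1 < s.re) :
    riemannZeta s = s / (s - 1) -
      s * ∫ t in Set.Ioi (1 : ℝ), ((Int.fract t : ℝ) : ℂ) * (t : ℂ) ^ (-(s + 1)) := by
  have h := LSeries_eq_mul_integral_of_nonneg (fun _ => (1 : ℝ)) (r := 1) zero_le_one hs
    (by simpa using Asymptotics.isBigO_refl (fun n : ℕ => (n : ℝ)) atTop) (by simp)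
  have h1 : LSeries (fun _ => ((1 : ℝ) : ℂ)) s = riemannZeta s := by
    simpa [Pi.one_def] using LSeries_one_eq_riemannZeta hs
  rw [h1] at h
  have hs1 : s - 1 ≠ 0 := by
    intro h0; rw [sub_eq_zero] at h0; simp [h0] at hs
  have hint : IntegrableOn (fun t : ℝ => (t : ℂ) ^ (-s)) (Set.Ioi 1) :=
    integrableOn_Ioi_cpow_of_lt (by simpa using hs) zero_lt_one
  have hint2 := integrableOn_fract_mul_cpow hs.le
  have h2 : ∫ t in Set.Ioi (1 : ℝ), (t : ℂ) ^ (-s) = 1 / (s - 1) := by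
    rw [integral_Ioi_cpow_of_lt (by simpa using hs) zero_lt_one]
    have : -s + 1 ≠ 0 := by intro h; apply hs1; linear_combination -h
    simp only [Complex.ofReal_one, Complex.one_cpow]
    field_simp
    ring
  have h3 : (∫ t in Set.Ioi (1 : ℝ), (∑ k ∈ Finset.Icc 1 ⌊t⌋₊, ((1 : ℝ) : ℂ)) * (t : ℂ) ^ (-(s + 1)))
      = ∫ t in Set.Ioi (1 : ℝ), ((t : ℂ) ^ (-s) -
          ((Int.fract t : ℝ) : ℂ) * (t : ℂ) ^ (-(s + 1))) := by
    refine setIntegral_congr_fun measurableSet_Ioi fun t ht => ?_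
    have ht1 : (1 : ℝ) < t := ht
    have ht0 : (t : ℂ) ≠ 0 := by exact_mod_cast (by linarith : t ≠ 0)
    have e1 : ((⌊t⌋₊ : ℝ) : ℂ) = (t : ℂ) - ((Int.fract t : ℝ) : ℂ) := by
      rw [← Complex.ofReal_sub]
      congr 1
      have := natCast_floor_eq_intCast_floor (R := ℝ) (by linarith : (0 : ℝ) ≤ t)
      rw [this]; have := Int.self_sub_fract t; linarith
    have e2 : (t : ℂ) ^ (-s) = t * (t : ℂ) ^ (-(s + 1)) := by
      rw [show -s = 1 + (-(s + 1)) by ring, Complex.cpow_add _ _ ht0, Complex.cpow_one]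
    simp only [Complex.ofReal_one, Finset.sum_const, Nat.card_Icc, add_tsub_cancel_right,
      nsmul_eq_mul, mul_one]
    rw [e2, ← Complex.ofReal_natCast, e1]; ring
  rw [h, h3, integral_sub hint hint2, h2]
  ring

lemma norm_fract_mul_cpow_le {s : ℂ} (hs : 1 ≤ s.re) {t : ℝ} (ht : 1 < t) :
    ‖((Int.fract t : ℝ) : ℂ) * (t : ℂ) ^ (-(s + 1))‖ ≤ t ^ (-2 : ℝ) := by
  rw [norm_mul, Complex.norm_real, Real.norm_of_nonneg (Int.fract_nonneg t),
    Complex.norm_cpow_eq_rpow_re_of_pos (by linarith)]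
  calc Int.fract t * t ^ (-(s + 1)).re ≤ 1 * t ^ (-(s + 1)).re := by
        gcongr; exact (Int.fract_lt_one t).le
    _ ≤ t ^ (-2 : ℝ) := by
        rw [one_mul]
        exact Real.rpow_le_rpow_of_exponent_le ht.le (by simp; linarith)

lemma norm_integral_fract_le {s : ℂ} (hs : 1 ≤ s.re) :
    ‖∫ t in Set.Ioi (1 : ℝ), ((Int.fract t : ℝ) : ℂ) * (t : ℂ) ^ (-(s + 1))‖ ≤ 1 := by
  have h0 : IntegrableOn (fun t : ℝ => t ^ (-2 : ℝ)) (Set.Ioi 1) :=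
    integrableOn_Ioi_rpow_of_lt (by norm_num) zero_lt_one
  refine (norm_integral_le_of_norm_le h0 ?_).trans ?_
  · filter_upwards [ae_restrict_mem measurableSet_Ioi] with t ht
    exact norm_fract_mul_cpow_le hs ht
  · rw [integral_Ioi_rpow_of_lt (by norm_num) zero_lt_one]; norm_num

/-- A Lipschitz bound in the real direction that replaces an estimate of `ζ'`. It uses `1 - t^(-x) ≤
x log t ≤ 2 x √t`; the loss of `√t` still leaves `t^(-3/2)`, whose integral is `2`. -/
lemma norm_integral_fract_sub_le {s : ℂ} {x : ℝ} (hs : 1 ≤ s.re) (hx : 0 ≤ x) :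
    ‖(∫ t in Set.Ioi (1 : ℝ), ((Int.fract t : ℝ) : ℂ) * (t : ℂ) ^ (-(s + 1))) -
      ∫ t in Set.Ioi (1 : ℝ), ((Int.fract t : ℝ) : ℂ) * (t : ℂ) ^ (-(s + x + 1))‖ ≤ 4 * x := by
  have hs' : 1 ≤ (s + x).re := by simp; linarith
  rw [← integral_sub (integrableOn_fract_mul_cpow hs) (integrableOn_fract_mul_cpow hs')]
  have h0 : IntegrableOn (fun t : ℝ => 2 * x * t ^ (-(3 / 2) : ℝ)) (Set.Ioi 1) :=
    (integrableOn_Ioi_rpow_of_lt (by norm_num) zero_lt_one).const_mul _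
  refine (norm_integral_le_of_norm_le h0 ?_).trans ?_
  · filter_upwards [ae_restrict_mem measurableSet_Ioi] with t ht
    have ht1 : (1 : ℝ) < t := ht
    have htp : 0 < t := by linarith
    have ht0 : (t : ℂ) ≠ 0 := by exact_mod_cast htp.ne'
    have e : (t : ℂ) ^ (-(s + x + 1)) = (t : ℂ) ^ (-(s + 1)) * ((t ^ (-x) : ℝ) : ℂ) := by
      rw [Complex.ofReal_cpow htp.le, ← Complex.cpow_add _ _ ht0]
      congr 1; push_cast; ring
    rw [e, ← mul_assoc]
    rw [show ∀ a b : ℂ, a - a * b = a * (1 - b) by intros; ring, norm_mul, ← Complex.ofReal_one,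
      ← Complex.ofReal_sub, Complex.norm_real]
    have h1 : ‖1 - t ^ (-x)‖ ≤ 2 * x * t ^ (1 / 2 : ℝ) := by
      have hle : t ^ (-x) ≤ 1 := Real.rpow_le_one_of_one_le_of_nonpos ht1.le (by linarith)
      rw [Real.norm_of_nonneg (by linarith)]
      have h2 : 1 - x * Real.log t ≤ t ^ (-x) := by
        rw [Real.rpow_def_of_pos htp]
        have := Real.add_one_le_exp (Real.log t * -x)
        nlinarith
      have h3 : Real.log t ≤ 2 * t ^ (1 / 2 : ℝ) := by
        have := Real.log_le_rpow_div htp.le (by norm_num : (0 : ℝ) < 1 / 2)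
        linarith
      nlinarith
    calc _ ≤ t ^ (-2 : ℝ) * (2 * x * t ^ (1 / 2 : ℝ)) := by
          gcongr
          exact norm_fract_mul_cpow_le hs ht1
      _ = 2 * x * (t ^ (-2 : ℝ) * t ^ (1 / 2 : ℝ)) := by ring
      _ = _ := by rw [← Real.rpow_add htp]; norm_num
  · rw [integral_const_mul, integral_Ioi_rpow_of_lt (by norm_num) zero_lt_one]; norm_num; linarith

lemma norm_riemannZeta_le_of_one_le_abs_im {s : ℂ} (h1 : 1 < s.re) (h2 : s.re ≤ 2)
    (hi : 1 ≤ |s.im|) : ‖riemannZeta s‖ ≤ 6 * |s.im| := by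
  rw [riemannZeta_eq_sub_integral_fract h1]
  have hn : ‖s‖ ≤ 3 * |s.im| := by
    have := Complex.norm_le_abs_re_add_abs_im s
    rw [abs_of_pos (by linarith)] at this
    linarith
  have hd : 1 ≤ ‖s - 1‖ := hi.trans (by simpa using Complex.abs_im_le_norm (s - 1))
  refine (norm_sub_le _ _).trans ?_
  rw [norm_div, norm_mul]
  have ha : ‖s‖ / ‖s - 1‖ ≤ ‖s‖ := div_le_self (norm_nonneg _) hd
  have hb := norm_integral_fract_le h1.le
  have := mul_le_mul_of_nonneg_left hb (norm_nonneg s)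
  linarith

lemma norm_riemannZeta_one_add_le {x : ℝ} (h1 : 0 < x) (h2 : x ≤ 1) :
    ‖riemannZeta (1 + x)‖ ≤ 4 / x := by
  have h : 1 < (1 + (x : ℂ)).re := by simpa using h1
  rw [riemannZeta_eq_sub_integral_fract h]
  have hn : ‖(1 + (x : ℂ))‖ = 1 + x := by
    rw [← Complex.ofReal_one, ← Complex.ofReal_add, Complex.norm_real,
      Real.norm_of_nonneg (by linarith)]
  refine (norm_sub_le _ _).trans ?_
  rw [norm_div, norm_mul, add_sub_cancel_left, hn, Complex.norm_real, Real.norm_of_nonneg h1.le]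
  have hb := norm_integral_fract_le h.le
  have := mul_le_mul_of_nonneg_left hb (by linarith : 0 ≤ 1 + x)
  have h3 : (1 + x) * 1 ≤ 2 / x := by rw [le_div_iff₀ h1]; nlinarith
  have h4 : (1 + x) / x ≤ 2 / x := by gcongr; linarith
  have h5 : 4 / x = 2 / x + 2 / x := by ring
  linarith

lemma norm_riemannZeta_sub_le {s : ℂ} {x : ℝ} (h1 : 1 < s.re) (hx : 0 ≤ x) (h2 : s.re + x ≤ 2)
    (hi : 1 ≤ |s.im|) : ‖riemannZeta s - riemannZeta (s + x)‖ ≤ 14 * |s.im| * x := by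
  have h1' : 1 < (s + x).re := by simp; linarith
  have hd : 1 ≤ ‖s - 1‖ := hi.trans (by simpa using Complex.abs_im_le_norm (s - 1))
  have hd' : 1 ≤ ‖s + x - 1‖ := hi.trans (by simpa using Complex.abs_im_le_norm (s + x - 1))
  have hn : ‖s + x‖ ≤ 3 * |s.im| := by
    have := Complex.norm_le_abs_re_add_abs_im (s + x)
    rw [abs_of_pos (by linarith)] at this
    simp at this
    linarith
  rw [riemannZeta_eq_sub_integral_fract h1, riemannZeta_eq_sub_integral_fract h1']
  have hb := norm_integral_fract_le h1.le
  have hc := norm_integral_fract_sub_le h1.le hx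
  set A := ∫ t in Set.Ioi (1 : ℝ), ((Int.fract t : ℝ) : ℂ) * (t : ℂ) ^ (-(s + 1))
  set B := ∫ t in Set.Ioi (1 : ℝ), ((Int.fract t : ℝ) : ℂ) * (t : ℂ) ^ (-(s + x + 1))
  have n1 : s - 1 ≠ 0 := by rw [← norm_pos_iff]; linarith
  have n2 : s + x - 1 ≠ 0 := by rw [← norm_pos_iff]; linarith
  have e : s / (s - 1) - s * A - ((s + x) / (s + x - 1) - (s + x) * B) =
      x / ((s - 1) * (s + x - 1)) + x * A - (s + x) * (A - B) := by
    field_simp; ring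
  rw [e]
  have b1 : ‖(x : ℂ) / ((s - 1) * (s + x - 1))‖ ≤ x := by
    rw [norm_div, Complex.norm_real, Real.norm_of_nonneg hx, norm_mul]
    exact div_le_self hx (by nlinarith)
  have b2 : ‖(x : ℂ) * A‖ ≤ x := by
    rw [norm_mul, Complex.norm_real, Real.norm_of_nonneg hx]
    nlinarith
  have b3 : ‖(s + x) * (A - B)‖ ≤ 3 * |s.im| * (4 * x) := by
    rw [norm_mul]; gcongr
  calc _ ≤ ‖(x : ℂ) / ((s - 1) * (s + x - 1)) + x * A‖ + ‖(s + x) * (A - B)‖ := norm_sub_le _ _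
    _ ≤ _ := by
      have := norm_add_le ((x : ℂ) / ((s - 1) * (s + x - 1))) (x * A)
      nlinarith

/-- The integral formula is available only for `Re s > 1`, so the edge is reached by continuity of
zeta away from `1`. -/
lemma norm_riemannZeta_one_add_mul_I_sub_le {x y : ℝ} (hx : 0 ≤ x) (h2 : x < 1)
    (hi : 1 ≤ |y|) :
    ‖riemannZeta (1 + Complex.I * y) - riemannZeta (1 + x + Complex.I * y)‖ ≤ 14 * |y| * x := by
  have hc : Continuous fun u : ℝ => 1 + (u : ℂ) + Complex.I * y := by fun_prop
  have key : ∀ v : ℝ, Tendsto (fun u : ℝ => riemannZeta (1 + ((u + v : ℝ) : ℂ) + Complex.I * y))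
      (𝓝[>] 0) (𝓝 (riemannZeta (1 + (v : ℂ) + Complex.I * y))) := by
    intro v
    have hd : ContinuousAt riemannZeta (1 + (v : ℂ) + Complex.I * y) := by
      refine (differentiableAt_riemannZeta ?_).continuousAt
      intro h
      have := congrArg Complex.im h
      simp at this
      rw [this] at hi; simp at hi; linarith
    have hg : Tendsto (fun u : ℝ => 1 + ((u + v : ℝ) : ℂ) + Complex.I * y) (𝓝[>] 0)
        (𝓝 (1 + (v : ℂ) + Complex.I * y)) := by
      have : Continuous fun u : ℝ => 1 + ((u + v : ℝ) : ℂ) + Complex.I * y := by fun_prop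
      have := this.tendsto 0
      simp only [zero_add] at this
      exact this.mono_left nhdsWithin_le_nhds
    exact hd.tendsto.comp hg
  have k0 := key 0
  have k1 := key x
  simp only [Complex.ofReal_zero, add_zero] at k0
  refine le_of_tendsto (k0.sub k1).norm ?_
  have : Set.Ioo (0 : ℝ) (1 - x) ∈ 𝓝[>] (0 : ℝ) := Ioo_mem_nhdsGT (by linarith)
  filter_upwards [this] with u hu
  have := norm_riemannZeta_sub_le (s := 1 + (u : ℂ) + Complex.I * y) (x := x)
    (by simp [hu.1]) hx (by simp; linarith [hu.2]) (by simpa using hi)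
  simp only [Complex.add_im, Complex.one_im, Complex.ofReal_im, Complex.mul_im, Complex.I_re,
    Complex.I_im, Complex.ofReal_re] at this
  simp only [zero_mul, one_mul, zero_add, add_zero] at this
  rw [show 1 + ((u + x : ℝ) : ℂ) + Complex.I * y = 1 + (u : ℂ) + Complex.I * y + x by
    push_cast; ring]
  exact this

lemma one_le_norm_riemannZeta_product {x : ℝ} (hx : 0 < x) (y : ℝ) :
    1 ≤ ‖riemannZeta (1 + x)‖ ^ 3 * ‖riemannZeta (1 + x + Complex.I * y)‖ ^ 4 *
      ‖riemannZeta (1 + x + Complex.I * (2 * y : ℝ))‖ := by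
  have h := DirichletCharacter.norm_LFunction_product_ge_one (N := 1) (1 : DirichletCharacter ℂ 1) hx y
  rw [DirichletCharacter.LFunctionTrivChar, DirichletCharacter.LFunction_modOne_eq,
    DirichletCharacter.LFunction_modOne_eq, norm_mul, norm_mul, norm_pow, norm_pow] at h
  convert h using 4
  push_cast; ring

theorem exists_le_norm_riemannZeta_one_add_mul_I :
    ∃ c : ℝ, 0 < c ∧ ∀ y : ℝ, 1 ≤ |y| → c ≤ |y| ^ 4 * ‖riemannZeta (1 + Complex.I * y)‖ := by
  -- With `x = c / |y|⁵`, this `c` makes the upper bound for the 3-4-1 product exactly `1` when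
  -- `|ζ(1 + x + iy)|` is replaced by `28 c / |y|⁴`; here `768 = 4³ * 12`. A smaller value would
  -- contradict the lower bound `1`. Moving back to the line costs `14 |y| x`, which is half of `28
  -- c / |y|⁴`.
  set c : ℝ := 1 / (28 ^ 4 * 768) with hc
  have hcp : 0 < c := by positivity
  refine ⟨14 * c, by positivity, fun y hy => ?_⟩
  have hy0 : 0 < |y| := by linarith
  set x : ℝ := c / |y| ^ 5 with hx
  have hxp : 0 < x := by positivity
  have hx1 : x < 1 := by
    rw [hx, div_lt_one (by positivity)]
    exact lt_of_lt_of_le (by rw [hc]; norm_num) (one_le_pow₀ hy)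
  have h1 := one_le_norm_riemannZeta_product hxp y
  have h2 := norm_riemannZeta_one_add_le hxp hx1.le
  have h3 := norm_riemannZeta_le_of_one_le_abs_im (s := 1 + x + Complex.I * (2 * y : ℝ))
    (by simpa using hxp) (by simp; linarith) (by simp [abs_mul]; linarith)
  have h4 := norm_riemannZeta_one_add_mul_I_sub_le hxp.le hx1 hy
  have h3' : ‖riemannZeta (1 + x + Complex.I * (2 * y : ℝ))‖ ≤ 12 * |y| := by
    have e : (1 + x + Complex.I * (2 * y : ℝ)).im = 2 * y := by simp
    rw [e, abs_mul, abs_two] at h3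
    linarith
  set a := ‖riemannZeta (1 + x + Complex.I * y)‖
  have ha : 28 * c / |y| ^ 4 ≤ a := by
    by_contra hlt
    push Not at hlt
    have : ‖riemannZeta (1 + x)‖ ^ 3 * a ^ 4 * ‖riemannZeta (1 + x + Complex.I * (2 * y : ℝ))‖ <
        (4 / x) ^ 3 * (28 * c / |y| ^ 4) ^ 4 * (12 * |y|) := by
      have u1 : ‖riemannZeta (1 + x)‖ ^ 3 ≤ (4 / x) ^ 3 := by gcongr
      have u2 : a ^ 4 < (28 * c / |y| ^ 4) ^ 4 := by
        apply pow_lt_pow_left₀ hlt (norm_nonneg _) (by norm_num)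
      calc _ ≤ (4 / x) ^ 3 * a ^ 4 * (12 * |y|) := by gcongr
        _ < _ := by
          have : 0 < (4 / x) ^ 3 := by positivity
          gcongr
    have e : (4 / x) ^ 3 * (28 * c / |y| ^ 4) ^ 4 * (12 * |y|) = 1 := by
      rw [hx]
      field_simp
      rw [hc]; norm_num
    linarith
  have hb : a - 14 * |y| * x ≤ ‖riemannZeta (1 + Complex.I * y)‖ := by
    have := norm_sub_norm_le (riemannZeta (1 + x + Complex.I * y)) (riemannZeta (1 + Complex.I * y))
    rw [norm_sub_rev] at this
    linarith
  have e1 : 14 * |y| * x = 14 * c / |y| ^ 4 := by rw [hx]; field_simp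
  have e2 : 28 * c / |y| ^ 4 = 2 * (14 * c / |y| ^ 4) := by ring
  have : 14 * c / |y| ^ 4 ≤ ‖riemannZeta (1 + Complex.I * y)‖ := by linarith
  rwa [div_le_iff₀' (by positivity)] at this

/-! ### Growth of the completed zeta function in vertical strips -/

/-- A Mellin transform converging at the two edges of a closed strip is bounded on the strip. -/
lemma MellinConvergent.exists_norm_mellin_le {f : ℝ → ℂ} {a b : ℝ}
    (ha : MellinConvergent f a) (hb : MellinConvergent f b) :
    ∃ C : ℝ, ∀ s : ℂ, a ≤ s.re → s.re ≤ b → ‖mellin f s‖ ≤ C := by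
  refine ⟨∫ t in Set.Ioi (0 : ℝ), (‖(t : ℂ) ^ ((a : ℂ) - 1) • f t‖ +
    ‖(t : ℂ) ^ ((b : ℂ) - 1) • f t‖), fun s h1 h2 => ?_⟩
  refine norm_integral_le_of_norm_le (ha.norm.add hb.norm) ?_
  filter_upwards [ae_restrict_mem measurableSet_Ioi] with t ht
  have htp : (0 : ℝ) < t := ht
  simp only [norm_smul, Complex.norm_cpow_eq_rpow_re_of_pos htp, Complex.sub_re, Complex.one_re,
    Complex.ofReal_re]
  rw [← add_mul]
  gcongr
  have p1 := Real.rpow_nonneg htp.le (a - 1)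
  have p2 := Real.rpow_nonneg htp.le (b - 1)
  rcases le_total 1 t with h | h
  · have := Real.rpow_le_rpow_of_exponent_le h (by linarith : s.re - 1 ≤ b - 1)
    linarith
  · have := Real.rpow_le_rpow_of_exponent_ge htp h (by linarith : a - 1 ≤ s.re - 1)
    linarith

/-- The entire part of `Λ` is by construction a Mellin transform that converges at every exponent,
hence bounded on each closed vertical strip. -/
lemma exists_norm_completedRiemannZeta₀_le (a b : ℝ) :
    ∃ C : ℝ, ∀ s : ℂ, a ≤ s.re → s.re ≤ b → ‖completedRiemannZeta₀ s‖ ≤ C := by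
  have hm : ∀ s : ℂ, MellinConvergent (HurwitzZeta.hurwitzEvenFEPair 0).f_modif s := fun s =>
    ((HurwitzZeta.hurwitzEvenFEPair 0).isStrongFEPair_toStrongFEPair.hasMellin s).1
  obtain ⟨C, hC⟩ := (hm (a / 2 : ℝ)).exists_norm_mellin_le (hm (b / 2 : ℝ))
  refine ⟨C / 2, fun s h1 h2 => ?_⟩
  have e : completedRiemannZeta₀ s = mellin (HurwitzZeta.hurwitzEvenFEPair 0).f_modif (s / 2) / 2 :=
    rfl
  rw [e, norm_div, Complex.norm_ofNat]
  have hre : (s / 2).re = s.re / 2 := by simp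
  have := hC (s / 2) (by rw [hre]; linarith) (by rw [hre]; linarith)
  linarith

/-- The function `(z - 1) Λ(z)`, whose only pole is at `0`. -/
noncomputable def shiftedZeta (z : ℂ) : ℂ :=
  (z - 1) * completedRiemannZeta₀ z - (z - 1) / z + 1

lemma shiftedZeta_eq {z : ℂ} (hz : z ≠ 1) : shiftedZeta z = (z - 1) * completedRiemannZeta z := by
  have h : 1 - z ≠ 0 := sub_ne_zero.mpr hz.symm
  have h2 : (z - 1) * (1 / (1 - z)) = -1 := by
    rw [← neg_sub 1 z]; field_simp
  rw [completedRiemannZeta_eq, shiftedZeta, mul_sub, mul_sub, h2]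
  ring

@[simp] lemma shiftedZeta_one : shiftedZeta 1 = 1 := by simp [shiftedZeta]

lemma differentiableAt_shiftedZeta {z : ℂ} (hz : z ≠ 0) : DifferentiableAt ℂ shiftedZeta z := by
  have := differentiable_completedZeta₀ z
  unfold shiftedZeta
  fun_prop (disch := assumption)

lemma analyticAt_shiftedZeta {z : ℂ} (hz : z ≠ 0) : AnalyticAt ℂ shiftedZeta z := by
  rw [Complex.analyticAt_iff_eventually_differentiableAt]
  filter_upwards [isOpen_ne.mem_nhds hz] with w hw using differentiableAt_shiftedZeta hw

lemma meromorphicAt_completedRiemannZeta (z : ℂ) : MeromorphicAt completedRiemannZeta z := by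
  have := (Complex.analyticAt_iff_eventually_differentiableAt.mpr
    (Eventually.of_forall differentiable_completedZeta₀) :
      AnalyticAt ℂ completedRiemannZeta₀ z).meromorphicAt
  have e : completedRiemannZeta = fun s => completedRiemannZeta₀ s - 1 / s - 1 / (1 - s) :=
    funext completedRiemannZeta_eq
  rw [e]
  fun_prop

lemma exists_norm_shiftedZeta_le {a b : ℝ} (ha : 0 < a) :
    ∃ C : ℝ, 0 ≤ C ∧ ∀ z : ℂ, a ≤ z.re → z.re ≤ b → ‖shiftedZeta z‖ ≤ C * (1 + |z.im|) := by
  obtain ⟨C, hC⟩ := exists_norm_completedRiemannZeta₀_le a b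
  refine ⟨(|b| + 1) * |C| + (|b| + 1) / a + 1, by positivity, fun z h1 h2 => ?_⟩
  have hb : 0 ≤ |b| := abs_nonneg b
  have hi : 0 ≤ |z.im| := abs_nonneg _
  have h3 : ‖z - 1‖ ≤ (|b| + 1) * (1 + |z.im|) := by
    have := norm_sub_le z 1
    have h4 := Complex.norm_le_abs_re_add_abs_im z
    rw [abs_of_pos (by linarith)] at h4
    rw [norm_one] at this
    have := le_abs_self b
    nlinarith
  have h4 : ‖completedRiemannZeta₀ z‖ ≤ |C| := (hC z h1 h2).trans (le_abs_self C)
  have h5 : a ≤ ‖z‖ := h1.trans ((le_abs_self _).trans (Complex.abs_re_le_norm z))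
  unfold shiftedZeta
  calc _ ≤ ‖z - 1‖ * ‖completedRiemannZeta₀ z‖ + ‖z - 1‖ / ‖z‖ + 1 := by
        refine (norm_add_le _ _).trans ?_
        rw [norm_one]
        gcongr
        refine (norm_sub_le _ _).trans ?_
        rw [norm_mul, norm_div]
    _ ≤ (|b| + 1) * (1 + |z.im|) * |C| + (|b| + 1) * (1 + |z.im|) / a + 1 * (1 + |z.im|) := by
        gcongr; linarith
    _ = _ := by ring

lemma shiftedZeta_ne_zero_of_one_le_re {z : ℂ} (hz : 1 ≤ z.re) : shiftedZeta z ≠ 0 := by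
  by_cases h1 : z = 1
  · simp [h1]
  rw [shiftedZeta_eq h1]
  have h0 : z ≠ 0 := by rintro rfl; simp at hz; linarith
  have h := riemannZeta_ne_zero_of_one_le_re hz
  rw [riemannZeta_def_of_ne_zero h0] at h
  exact mul_ne_zero (sub_ne_zero.mpr h1) (fun h' => h (by simp [h']))

/-! ### The denominator Λ(1 + 2μ) Λ(1 - 2μ) on the imaginary axis -/

/-- On the line `Re z = 1/2` the reflection `z ↦ 1 - z` is complex conjugation, so the reflection
formula computes the modulus. -/
lemma norm_Gamma_half_add_mul_I_sq (t : ℝ) :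
    ‖Complex.Gamma (1 / 2 + Complex.I * t)‖ ^ 2 = Real.pi / Real.cosh (Real.pi * t) := by
  have h := Complex.Gamma_mul_Gamma_one_sub (1 / 2 + Complex.I * t)
  have e : 1 - (1 / 2 + Complex.I * t) = (starRingEnd ℂ) (1 / 2 + Complex.I * t) := by
    apply Complex.ext <;> norm_num
  rw [e, Complex.Gamma_conj, Complex.mul_conj, Complex.normSq_eq_norm_sq] at h
  have e2 : Complex.sin (Real.pi * (1 / 2 + Complex.I * t)) = (Real.cosh (Real.pi * t) : ℝ) := by
    rw [show (Real.pi : ℂ) * (1 / 2 + Complex.I * t) = (Real.pi * t : ℝ) * Complex.I + Real.pi / 2 by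
      push_cast; ring, Complex.sin_add_pi_div_two, Complex.cos_mul_I, ← Complex.ofReal_cosh]
  rw [e2] at h
  exact_mod_cast h

lemma norm_completedRiemannZeta_one_add_sq (t : ℝ) :
    ‖completedRiemannZeta (1 + 2 * (t * Complex.I))‖ ^ 2 =
      ‖riemannZeta (1 + Complex.I * (2 * t : ℝ))‖ ^ 2 / Real.cosh (Real.pi * t) := by
  set z : ℂ := 1 + Complex.I * (2 * t : ℝ) with hz
  have e0 : 1 + 2 * (t * Complex.I) = z := by rw [hz]; push_cast; ring
  have h0 : z ≠ 0 := by
    intro h; have := congrArg Complex.re h; simp [hz] at this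
  have e2 : z / 2 = 1 / 2 + Complex.I * t := by rw [hz]; push_cast; ring
  have hG : ‖Complex.Gammaℝ z‖ ^ 2 = 1 / Real.cosh (Real.pi * t) := by
    rw [Complex.Gammaℝ_def, norm_mul, mul_pow, e2, norm_Gamma_half_add_mul_I_sq,
      Complex.norm_cpow_eq_rpow_re_of_pos Real.pi_pos]
    have : (-z / 2).re = -(1 / 2) := by simp [hz, neg_div]
    rw [this, ← Real.rpow_natCast, ← Real.rpow_mul Real.pi_pos.le]
    norm_num [Real.rpow_neg_one]
    field_simp
  have hGp : Complex.Gammaℝ z ≠ 0 := Complex.Gammaℝ_ne_zero_of_re_pos (by simp [hz])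
  rw [e0, riemannZeta_def_of_ne_zero h0, norm_div, div_pow, hG]
  have := (Real.cosh_pos (Real.pi * t)).ne'
  field_simp

/-- Compactness handles `|t| ≤ 1`, where `shiftedZeta` has no zero. Beyond that, each of the two `Λ`
factors costs `(1 + |t|)⁴` from zeta and `e^{π|t|/2}` from Gamma. -/
lemma exists_sq_div_norm_shiftedZeta_le :
    ∃ C : ℝ, 0 ≤ C ∧ ∀ t : ℝ, t ^ 2 / ‖shiftedZeta (1 + 2 * (t * Complex.I)) *
      shiftedZeta (1 - 2 * (t * Complex.I))‖ ≤ C * (1 + |t|) ^ 8 * Real.exp (Real.pi * |t|) := by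
  obtain ⟨c, hc, hz⟩ := exists_le_norm_riemannZeta_one_add_mul_I
  have hconj : ∀ t : ℝ, t ≠ 0 → ‖shiftedZeta (1 + 2 * (t * Complex.I)) *
      shiftedZeta (1 - 2 * (t * Complex.I))‖ = 4 * t ^ 2 *
        (‖completedRiemannZeta (1 + 2 * (t * Complex.I))‖ *
          ‖completedRiemannZeta (1 + 2 * ((-t : ℝ) * Complex.I))‖) := by
    intro t ht
    have e : (1 : ℂ) - 2 * (t * Complex.I) = 1 + 2 * ((-t : ℝ) * Complex.I) := by push_cast; ring
    have hne : ∀ u : ℝ, u ≠ 0 → (1 : ℂ) + 2 * (u * Complex.I) ≠ 1 := by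
      intro u hu h; apply hu; simpa using h
    rw [e, shiftedZeta_eq (hne t ht), shiftedZeta_eq (hne (-t) (neg_ne_zero.mpr ht))]
    simp only [add_sub_cancel_left, norm_mul, Complex.norm_I, Complex.norm_real, norm_neg,
      Complex.norm_ofNat, Complex.ofReal_neg, neg_mul, Real.norm_eq_abs]
    rw [← sq_abs t]; ring
  have hcont : ContinuousOn (fun t : ℝ => t ^ 2 / ‖shiftedZeta (1 + 2 * (t * Complex.I)) *
      shiftedZeta (1 - 2 * (t * Complex.I))‖) (Set.Icc (-1) 1) := by
    refine Continuous.continuousOn ?_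
    have h1 : ∀ u : ℝ, ContinuousAt (fun t : ℝ => shiftedZeta (1 + 2 * (t * Complex.I))) u := by
      intro u
      refine ContinuousAt.comp (g := shiftedZeta)
        (differentiableAt_shiftedZeta fun h => ?_).continuousAt (by fun_prop)
      have := congrArg Complex.re h; simp at this
    have h2 : ∀ u : ℝ, ContinuousAt (fun t : ℝ => shiftedZeta (1 - 2 * (t * Complex.I))) u := by
      intro u
      refine ContinuousAt.comp (g := shiftedZeta)
        (differentiableAt_shiftedZeta fun h => ?_).continuousAt (by fun_prop)
      have := congrArg Complex.re h; simp at this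
    refine Continuous.div₀ (by fun_prop)
      ((continuous_iff_continuousAt.mpr h1).mul (continuous_iff_continuousAt.mpr h2)).norm
      fun t => ?_
    rw [norm_ne_zero_iff]
    exact mul_ne_zero (shiftedZeta_ne_zero_of_one_le_re (by simp))
      (shiftedZeta_ne_zero_of_one_le_re (by simp))
  obtain ⟨M, hM⟩ := (isCompact_Icc.bddAbove_image hcont)
  refine ⟨|M| + 4 ^ 8 / c ^ 2, by positivity, fun t => ?_⟩
  have hE : 1 ≤ Real.exp (Real.pi * |t|) := Real.one_le_exp (by positivity)
  have hP : 1 ≤ (1 + |t|) ^ 8 := one_le_pow₀ (by linarith [abs_nonneg t])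
  rcases le_or_gt |t| 1 with h | h
  · have := hM ⟨t, abs_le.mp h, rfl⟩
    calc _ ≤ |M| * 1 * 1 := by rw [mul_one, mul_one]; exact this.trans (le_abs_self M)
      _ ≤ _ := by
        gcongr
        have : 0 ≤ (4 : ℝ) ^ 8 / c ^ 2 := by positivity
        linarith
  · have ht : t ≠ 0 := by rintro rfl; simp at h; linarith
    have key : ∀ u : ℝ, 1 < |u| → c / (4 * (1 + |u|)) ^ 4 * Real.exp (-(Real.pi * |u|) / 2) ≤
        ‖completedRiemannZeta (1 + 2 * (u * Complex.I))‖ := by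
      intro u hu
      have hz1 := hz (2 * u) (by rw [abs_mul, abs_two]; linarith)
      refine le_of_sq_le_sq ?_ (norm_nonneg _)
      rw [norm_completedRiemannZeta_one_add_sq, mul_pow, ← Real.exp_nat_mul]
      have hz2 : c / (4 * (1 + |u|)) ^ 4 ≤ ‖riemannZeta (1 + Complex.I * (2 * u : ℝ))‖ := by
        rw [div_le_iff₀' (by positivity)]
        refine hz1.trans ?_
        gcongr
        rw [abs_mul, abs_two]; linarith
      have hcosh : Real.cosh (Real.pi * u) ≤ Real.exp (Real.pi * |u|) := by
        rw [← Real.cosh_abs, abs_mul, abs_of_pos Real.pi_pos, Real.cosh_eq]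
        have : Real.exp (-(Real.pi * |u|)) ≤ Real.exp (Real.pi * |u|) := by
          apply Real.exp_le_exp.mpr
          have : 0 ≤ Real.pi * |u| := by positivity
          linarith
        linarith
      rw [div_eq_mul_inv (‖riemannZeta (1 + Complex.I * (2 * u : ℝ))‖ ^ 2)]
      gcongr
      rw [show ((2 : ℕ) : ℝ) * (-(Real.pi * |u|) / 2) = -(Real.pi * |u|) by push_cast; ring,
        Real.exp_neg]
      gcongr
    have k1 := key t h
    have k2 := key (-t) (by rwa [abs_neg])
    rw [abs_neg] at k2
    rw [hconj t ht]
    set Y := c / (4 * (1 + |t|)) ^ 4 * Real.exp (-(Real.pi * |t|) / 2) with hY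
    have hYp : 0 < Y := by positivity
    have e : 1 / (Y * Y) = 4 ^ 8 / c ^ 2 * (1 + |t|) ^ 8 * Real.exp (Real.pi * |t|) := by
      have hexp : Real.exp (-(Real.pi * |t|) / 2) * Real.exp (-(Real.pi * |t|) / 2) *
          Real.exp (Real.pi * |t|) = 1 := by
        rw [← Real.exp_add, ← Real.exp_add, ← Real.exp_zero]; congr 1; ring
      rw [div_eq_iff (by positivity), hY]
      have : (1 + |t|) ≠ 0 := by positivity
      calc (1 : ℝ) = Real.exp (-(Real.pi * |t|) / 2) * Real.exp (-(Real.pi * |t|) / 2) *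
          Real.exp (Real.pi * |t|) := hexp.symm
        _ = _ := by field_simp
    calc _ = (1 / 4) * (1 / (‖completedRiemannZeta (1 + 2 * (t * Complex.I))‖ *
          ‖completedRiemannZeta (1 + 2 * ((-t : ℝ) * Complex.I))‖)) := by field_simp
      _ ≤ 1 * (1 / (Y * Y)) := by gcongr; norm_num
      _ ≤ _ := by
        rw [one_mul, e]
        gcongr
        have := abs_nonneg M
        linarith

/-! ### Holomorphic parameter integrals and removable singularities -/

/-- A dominated integral of holomorphic functions is holomorphic. -/
lemma analyticAt_integral_of_dominated {X : Type*} [MeasurableSpace X] {ν : Measure X}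
    {g : ℂ → X → ℂ} {s₀ : ℂ} {r : ℝ} (hr : 0 < r) {b : X → ℝ}
    (hmeas : ∀ s ∈ Metric.ball s₀ r, AEStronglyMeasurable (g s) ν)
    (hd : ∀ᵐ x ∂ν, DifferentiableOn ℂ (fun s => g s x) (Metric.ball s₀ r))
    (hb : ∀ᵐ x ∂ν, ∀ s ∈ Metric.ball s₀ r, ‖g s x‖ ≤ b x) (hbi : Integrable b ν) :
    AnalyticAt ℂ (fun s => ∫ x, g s x ∂ν) s₀ := by
  rw [Complex.analyticAt_iff_eventually_differentiableAt]
  filter_upwards [Metric.ball_mem_nhds s₀ (half_pos hr)] with s₁ hs₁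
  set ρ := r / 4 with hρ
  have hρ0 : 0 < ρ := by positivity
  have hsub : ∀ z ∈ Metric.ball s₁ ρ, Metric.closedBall z ρ ⊆ Metric.ball s₀ r := by
    intro z hz w hw
    rw [Metric.mem_ball] at *
    rw [Metric.mem_closedBall] at hw
    have := dist_triangle w z s₀
    have := dist_triangle z s₁ s₀
    linarith
  have hs₁' : s₁ ∈ Metric.ball s₀ r := Metric.ball_subset_ball (by linarith) hs₁
  have hdat : ∀ x, DifferentiableOn ℂ (fun s => g s x) (Metric.ball s₀ r) →
      ∀ z ∈ Metric.ball s₀ r, HasDerivAt (fun s => g s x) (deriv (fun s => g s x) z) z :=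
    fun x hx z hz => (hx.differentiableAt (Metric.isOpen_ball.mem_nhds hz)).hasDerivAt
  refine (hasDerivAt_integral_of_dominated_loc_of_deriv_le (s := Metric.ball s₁ ρ)
    (F' := fun s x => deriv (fun s => g s x) s) (bound := fun x => b x / ρ)
    (Metric.ball_mem_nhds _ hρ0) ?_ ?_ ?_ ?_ (hbi.div_const _) ?_).2.differentiableAt
  · filter_upwards [Metric.isOpen_ball.mem_nhds hs₁'] with s hs using hmeas s hs
  · exact Integrable.mono' hbi (hmeas s₁ hs₁') (hb.mono fun x hx => hx s₁ hs₁')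
  -- Measurability of the derivative in `x`: it is the pointwise limit of difference quotients along
  -- a sequence that stays within `ρ` of `s₁`.
  · have hseq : Tendsto (fun n : ℕ => s₁ + ((ρ / (n + 2) : ℝ) : ℂ)) atTop (𝓝[≠] s₁) := by
      rw [tendsto_nhdsWithin_iff]
      constructor
      · have h1 : Tendsto (fun n : ℕ => ρ / ((n : ℝ) + 2)) atTop (𝓝 0) :=
          tendsto_const_nhds.div_atTop (tendsto_natCast_atTop_atTop.atTop_add tendsto_const_nhds)
        have h2 := (Complex.continuous_ofReal.tendsto 0).comp h1
        simpa using h2.const_add s₁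
      · refine Eventually.of_forall fun n => ?_
        have : ρ / ((n : ℝ) + 2) ≠ 0 := by positivity
        simp only [Set.mem_compl_iff, Set.mem_singleton_iff, add_eq_left]
        exact_mod_cast this
    refine aestronglyMeasurable_of_tendsto_ae atTop
      (f := fun (n : ℕ) x => slope (fun s => g s x) s₁ (s₁ + ((ρ / (n + 2) : ℝ) : ℂ))) ?_ ?_
    · intro n
      have hm : s₁ + ((ρ / (n + 2) : ℝ) : ℂ) ∈ Metric.ball s₀ r := by
        refine hsub s₁ (Metric.mem_ball_self hρ0) ?_
        rw [Metric.mem_closedBall, dist_eq_norm, add_sub_cancel_left, Complex.norm_real,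
          Real.norm_of_nonneg (by positivity)]
        exact div_le_self hρ0.le (by have : (0 : ℝ) ≤ n := n.cast_nonneg
                                     linarith)
      simp only [slope_def_field]
      exact ((hmeas _ hm).sub (hmeas _ hs₁')).div₀ aestronglyMeasurable_const
    · filter_upwards [hd] with x hx
      exact (hasDerivAt_iff_tendsto_slope.mp (hdat x hx s₁ hs₁')).comp hseq
  -- Cauchy's estimate on circles of radius `ρ` dominates the derivative by `b / ρ`.
  · filter_upwards [hd, hb] with x hx hbx z hz
    refine Complex.norm_deriv_le_of_forall_mem_sphere_norm_le hρ0 ?_ fun w hw =>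
      hbx w (hsub z hz (Metric.sphere_subset_closedBall hw))
    refine (hx.mono (hsub z hz)).diffContOnCl_ball subset_rfl
  · filter_upwards [hd] with x hx z hz
    exact hdat x hx z (hsub z hz (Metric.mem_closedBall_self hρ0.le))

/-- Division of a holomorphic function by a linear factor at a zero. -/
lemma exists_differentiableOn_div_sub {U : Set ℂ} (hU : IsOpen U) {u : ℂ → ℂ}
    (hu : DifferentiableOn ℂ u U) {a : ℂ} (ha : a ∈ U → u a = 0) :
    ∃ v : ℂ → ℂ, DifferentiableOn ℂ v U ∧ ∀ s, s ≠ a → v s = u s / (s - a) := by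
  by_cases h : a ∈ U
  · refine ⟨dslope u a, (Complex.differentiableOn_dslope (hU.mem_nhds h)).mpr hu, fun s hs => ?_⟩
    rw [dslope_of_ne _ hs, slope_def_field, ha h, sub_zero]
  · refine ⟨fun s => u s / (s - a), hu.div (by fun_prop) fun s hs => ?_, fun s _ => rfl⟩
    rw [sub_ne_zero]; rintro rfl; exact h hs

/-- The candidates `2r`, `4r`, `6r` are spaced by `2r`, so each of `x` and `y` comes within `r` of
at most one of them, and one candidate survives. -/
lemma exists_radius {r : ℝ} (hr : 0 < r) (x y : ℝ) :
    ∃ ρ, r ≤ ρ ∧ ρ ≤ 6 * r ∧ r ≤ |ρ - x| ∧ r ≤ |ρ - y| := by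
  by_cases h2 : r ≤ |2 * r - x| ∧ r ≤ |2 * r - y|
  · exact ⟨2 * r, by linarith, by linarith, h2.1, h2.2⟩
  by_cases h4 : r ≤ |4 * r - x| ∧ r ≤ |4 * r - y|
  · exact ⟨4 * r, by linarith, by linarith, h4.1, h4.2⟩
  refine ⟨6 * r, by linarith, by linarith, ?_, ?_⟩ <;>
  · by_contra h6
    simp only [not_and_or, not_le, abs_lt] at h2 h4 h6
    rcases h2 with h2 | h2 <;> rcases h4 with h4 | h4 <;>
      linarith [h2.1, h2.2, h4.1, h4.2, h6.1, h6.2]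

/-- Division of a bounded holomorphic function by two linear factors at zeros, with a bound. -/
lemma exists_differentiableOn_div_sub_mul_sub {s₀ : ℂ} {r M : ℝ} (hr : 0 < r) {u : ℂ → ℂ}
    (hu : DifferentiableOn ℂ u (Metric.ball s₀ (8 * r)))
    (hM : ∀ s ∈ Metric.ball s₀ (8 * r), ‖u s‖ ≤ M) {a b : ℂ} (hab : a ≠ b)
    (ha : a ∈ Metric.ball s₀ (8 * r) → u a = 0) (hb : b ∈ Metric.ball s₀ (8 * r) → u b = 0) :
    ∃ v : ℂ → ℂ, DifferentiableOn ℂ v (Metric.ball s₀ (8 * r)) ∧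
      (∀ s, s ≠ a → s ≠ b → v s = u s / ((s - a) * (s - b))) ∧
      ∀ s ∈ Metric.ball s₀ r, ‖v s‖ ≤ 64 * M / ((r + ‖a - s₀‖) * (r + ‖b - s₀‖)) := by
  obtain ⟨v₁, hv₁, e₁⟩ := exists_differentiableOn_div_sub Metric.isOpen_ball hu ha
  obtain ⟨v, hv, e⟩ := exists_differentiableOn_div_sub Metric.isOpen_ball hv₁ (a := b)
    (fun h => by rw [e₁ b hab.symm, hb h, zero_div])
  have e' : ∀ s, s ≠ a → s ≠ b → v s = u s / ((s - a) * (s - b)) := fun s h1 h2 => by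
    rw [e s h2, e₁ s h1, div_div]
  have hM0 : 0 ≤ M := (norm_nonneg _).trans (hM s₀ (Metric.mem_ball_self (by linarith)))
  refine ⟨v, hv, e', fun s hs => ?_⟩
  obtain ⟨ρ, h1, h2, h3, h4⟩ := exists_radius hr ‖a - s₀‖ ‖b - s₀‖
  have hρ : 0 < ρ := by linarith
  have hcb : Metric.closedBall s₀ ρ ⊆ Metric.ball s₀ (8 * r) :=
    Metric.closedBall_subset_ball (by linarith)
  refine Complex.norm_le_of_forall_mem_frontier_norm_le (U := Metric.ball s₀ ρ)
    Metric.isBounded_ball ((hv.mono hcb).diffContOnCl_ball subset_rfl) ?_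
    (subset_closure (Metric.ball_subset_ball h1 hs))
  rw [frontier_ball _ hρ.ne']
  intro z hz
  have hz' : ‖z - s₀‖ = ρ := by rwa [mem_sphere_iff_norm] at hz
  -- With `m = |ρ - ‖a - s₀‖| ≥ r` and `ρ ≤ 6r`, one has `r + ‖a - s₀‖ ≤ 7r + m ≤ 8m`. Two such
  -- factors give the `64`; the maximum principle carries the bound inside the circle.
  have key : ∀ a : ℂ, r ≤ |ρ - ‖a - s₀‖| → (r + ‖a - s₀‖) / 8 ≤ ‖z - a‖ := by
    intro a h3
    have k1 : |‖z - s₀‖ - ‖a - s₀‖| ≤ ‖z - a‖ := by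
      simpa using abs_norm_sub_norm_le (z - s₀) (a - s₀)
    rw [hz'] at k1
    have := neg_abs_le (ρ - ‖a - s₀‖)
    linarith
  have ka := key a h3
  have kb := key b h4
  have na := norm_nonneg (a - s₀)
  have nb := norm_nonneg (b - s₀)
  have za : z ≠ a := by rintro rfl; simp at ka; linarith
  have zb : z ≠ b := by rintro rfl; simp at kb; linarith
  rw [e' z za zb, norm_div, norm_mul]
  calc _ ≤ M / ((r + ‖a - s₀‖) / 8 * ((r + ‖b - s₀‖) / 8)) := by
        gcongr
        exact hM z (hcb (Metric.sphere_subset_closedBall hz))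
    _ = _ := by field_simp; norm_num

/-! ### Cauchy-type integrals against 1 / (p² + t²) -/

lemma one_add_abs_mul_le {δ D x t : ℝ} (hδ : 0 < δ) (hD : 0 ≤ D) (h1 : δ ≤ x) (h2 : |t| ≤ x + D) :
    δ / (1 + D + δ) * (1 + |t|) ≤ x := by
  rw [div_mul_eq_mul_div, div_le_iff₀ (by positivity)]
  nlinarith

lemma one_add_sq_le_of_le {δ D x y t : ℝ} (hδ : 0 < δ) (hD : 0 ≤ D) (h1 : δ ≤ x)
    (h2 : |t| ≤ x + D) (h3 : δ ≤ y) (h4 : |t| ≤ y + D) :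
    (δ / (1 + D + δ)) ^ 2 * (1 + t ^ 2) ≤ x * y := by
  have k1 := one_add_abs_mul_le hδ hD h1 h2
  have k2 := one_add_abs_mul_le hδ hD h3 h4
  have hκ : 0 < δ / (1 + D + δ) := by positivity
  have ht := abs_nonneg t
  calc _ ≤ (δ / (1 + D + δ)) ^ 2 * (1 + |t|) ^ 2 := by
        gcongr; rw [← sq_abs t]; nlinarith
    _ = (δ / (1 + D + δ) * (1 + |t|)) * (δ / (1 + D + δ) * (1 + |t|)) := by ring
    _ ≤ _ := mul_le_mul k1 k2 (by positivity) (hδ.le.trans h1)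

lemma sq_add_sq_eq (p : ℂ) (t : ℝ) :
    p ^ 2 + (t : ℂ) ^ 2 = (p - t * Complex.I) * (p + t * Complex.I) := by
  linear_combination (t : ℂ) ^ 2 * Complex.I_sq

lemma continuous_sq_add_sq (p : ℂ) : Continuous fun t : ℝ => p ^ 2 + (t : ℂ) ^ 2 := by
  fun_prop

/-- Each factor `p ∓ it` is at least `|Re p|` and at least `|t| - ‖p‖`. The first bound serves small
`t`, the second gives the quadratic growth, uniformly for `p` in a bounded set away from the
imaginary axis. -/
lemma one_add_sq_le_norm_sq_add_sq {p : ℂ} {δ D t : ℝ} (hδ : 0 < δ) (h1 : δ ≤ |p.re|)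
    (h2 : ‖p‖ ≤ D) : (δ / (1 + D + δ)) ^ 2 * (1 + t ^ 2) ≤ ‖p ^ 2 + (t : ℂ) ^ 2‖ := by
  rw [sq_add_sq_eq, norm_mul]
  have hD : 0 ≤ D := (norm_nonneg _).trans h2
  have ht : ‖(t : ℂ) * Complex.I‖ = |t| := by simp
  refine one_add_sq_le_of_le hδ hD ?_ ?_ ?_ ?_
  · exact h1.trans (by simpa using Complex.abs_re_le_norm (p - t * Complex.I))
  · have := norm_sub_norm_le (t * Complex.I) p
    rw [norm_sub_rev, ht] at this; linarith
  · exact h1.trans (by simpa using Complex.abs_re_le_norm (p + t * Complex.I))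
  · have := norm_sub_norm_le (t * Complex.I) (-p)
    rw [sub_neg_eq_add, add_comm, ht, norm_neg] at this; linarith

lemma sq_add_sq_ne_zero {p : ℂ} (hp : p.re ≠ 0) (t : ℝ) : p ^ 2 + (t : ℂ) ^ 2 ≠ 0 := by
  rw [sq_add_sq_eq]
  refine mul_ne_zero (fun h => hp ?_) fun h => hp ?_
  · simpa using congrArg Complex.re h
  · simpa using congrArg Complex.re h

lemma integrable_const_div_one_add_sq (C : ℝ) : Integrable fun t : ℝ => C / (1 + t ^ 2) := by
  simpa [div_eq_mul_inv] using integrable_inv_one_add_sq.const_mul C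

lemma norm_div_sq_add_sq_le {p z : ℂ} {δ D M t : ℝ} (hδ : 0 < δ) (h1 : δ ≤ |p.re|)
    (h2 : ‖p‖ ≤ D) (hz : ‖z‖ ≤ M) :
    ‖z / (p ^ 2 + (t : ℂ) ^ 2)‖ ≤ M / (δ / (1 + D + δ)) ^ 2 / (1 + t ^ 2) := by
  have hD : 0 ≤ D := (norm_nonneg _).trans h2
  have hM : 0 ≤ M := (norm_nonneg _).trans hz
  rw [norm_div, div_div]
  gcongr
  exact one_add_sq_le_norm_sq_add_sq hδ h1 h2

lemma integrable_div_sq_add_sq {φ : ℝ → ℂ} {p : ℂ} {M : ℝ} (hp : p.re ≠ 0)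
    (hφ : AEStronglyMeasurable φ) (hM : ∀ t, ‖φ t‖ ≤ M) :
    Integrable fun t : ℝ => φ t / (p ^ 2 + (t : ℂ) ^ 2) := by
  have h0 : 0 < |p.re| := abs_pos.mpr hp
  refine Integrable.mono' (integrable_const_div_one_add_sq _)
    (hφ.div₀ (continuous_sq_add_sq p).aestronglyMeasurable) (Eventually.of_forall fun t =>
      norm_div_sq_add_sq_le h0 le_rfl le_rfl (hM t))

lemma analyticAt_integral_div_sq_add_sq {φ : ℂ → ℝ → ℂ} {c s₀ : ℂ} {R M : ℝ} (hR : 0 < R)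
    (hp : (s₀ - c).re ≠ 0)
    (hφ : ∀ s ∈ Metric.ball s₀ R, AEStronglyMeasurable (φ s))
    (hd : ∀ t, DifferentiableOn ℂ (fun s => φ s t) (Metric.ball s₀ R))
    (hM : ∀ s ∈ Metric.ball s₀ R, ∀ t, ‖φ s t‖ ≤ M) :
    AnalyticAt ℂ (fun s => ∫ t : ℝ, φ s t / ((s - c) ^ 2 + (t : ℂ) ^ 2)) s₀ := by
  set δ := |(s₀ - c).re| / 2 with hδ
  have hδ0 : 0 < δ := half_pos (abs_pos.mpr hp)
  have hball : ∀ s ∈ Metric.ball s₀ (min R δ), s ∈ Metric.ball s₀ R ∧ δ ≤ |(s - c).re| ∧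
      ‖s - c‖ ≤ ‖s₀ - c‖ + δ := by
    intro s hs
    have h1 := Metric.ball_subset_ball (min_le_right R δ) hs
    rw [mem_ball_iff_norm] at h1
    refine ⟨Metric.ball_subset_ball (min_le_left R δ) hs, ?_, ?_⟩
    · have h2 := Complex.abs_re_le_norm (s - s₀)
      have h3 : |(s₀ - c).re| ≤ |(s - c).re| + |(s - s₀).re| := by
        have e : (s₀ - c).re = (s - c).re - (s - s₀).re := by simp
        rw [e]; exact abs_sub _ _
      linarith
    · have := norm_add_le (s - s₀) (s₀ - c)
      rw [sub_add_sub_cancel] at this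
      linarith
  refine analyticAt_integral_of_dominated (lt_min hR hδ0)
    (b := fun t => M / (δ / (1 + (‖s₀ - c‖ + δ) + δ)) ^ 2 / (1 + t ^ 2)) ?_ ?_ ?_
    (integrable_const_div_one_add_sq _)
  · intro s hs
    exact (hφ s (hball s hs).1).div₀ (continuous_sq_add_sq _).aestronglyMeasurable
  · refine Eventually.of_forall fun t => ?_
    refine ((hd t).mono fun s hs => (hball s hs).1).div (by fun_prop) fun s hs => ?_
    refine sq_add_sq_ne_zero (fun h => ?_) t
    have := (hball s hs).2.1
    rw [h, abs_zero] at this; linarith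
  · refine Eventually.of_forall fun t s hs => ?_
    obtain ⟨h1, h2, h3⟩ := hball s hs
    exact norm_div_sq_add_sq_le hδ0 h2 h3 (hM s h1 t)

/-- The regularized Cauchy-type integral is holomorphic across the line of integration. -/
lemma analyticAt_integral_sub_div_sq_add_sq {φ : ℂ → ℝ → ℂ} {ψ : ℂ → ℂ} {c s₀ : ℂ} {R M : ℝ}
    (hR : 0 < R) (hφ : ∀ s ∈ Metric.ball s₀ R, AEStronglyMeasurable (φ s))
    (hd : ∀ t, DifferentiableOn ℂ (fun s => φ s t) (Metric.ball s₀ R))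
    (hM : ∀ s ∈ Metric.ball s₀ R, ∀ t, ‖φ s t‖ ≤ M)
    (hψ : DifferentiableOn ℂ ψ (Metric.ball s₀ R))
    (hMψ : ∀ s ∈ Metric.ball s₀ R, ‖ψ s‖ ≤ M)
    (hcompat : ∀ s ∈ Metric.ball s₀ R, ∀ t : ℝ,
      (s - c = t * Complex.I ∨ s - c = -(t * Complex.I)) → φ s t = ψ s) :
    AnalyticAt ℂ (fun s => ∫ t : ℝ, (φ s t - ψ s) / ((s - c) ^ 2 + (t : ℂ) ^ 2)) s₀ := by
  set r := R / 8 with hr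
  have hr0 : 0 < r := by positivity
  have h8 : 8 * r = R := by rw [hr]; ring
  -- The numerator vanishes at both zeros `c ± it` of the denominator, so the quotient extends
  -- holomorphically in `s`, with a bound integrable in `t`. At `t = 0` the zeros merge; that null
  -- set is discarded.
  have hex : ∀ t : ℝ, ∃ v : ℂ → ℂ, t ≠ 0 → DifferentiableOn ℂ v (Metric.ball s₀ (8 * r)) ∧
      (∀ s, s ≠ c + t * Complex.I → s ≠ c - t * Complex.I →
        v s = (φ s t - ψ s) / ((s - (c + t * Complex.I)) * (s - (c - t * Complex.I)))) ∧
      ∀ s ∈ Metric.ball s₀ r, ‖v s‖ ≤ 64 * (2 * M) /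
        ((r + ‖c + t * Complex.I - s₀‖) * (r + ‖c - t * Complex.I - s₀‖)) := by
    intro t
    by_cases ht : t = 0
    · exact ⟨0, fun h => absurd ht h⟩
    have hab : c + t * Complex.I ≠ c - t * Complex.I := by
      intro h
      apply ht
      have := congrArg Complex.im h
      simp at this
      linarith
    obtain ⟨v, hv⟩ := exists_differentiableOn_div_sub_mul_sub (M := 2 * M) hr0
      (u := fun s => φ s t - ψ s)
      (by rw [h8]; exact (hd t).sub hψ)
      (by
        rw [h8]; intro s hs
        have := norm_sub_le (φ s t) (ψ s)
        have := hM s hs t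
        have := hMψ s hs
        linarith) hab
      (by rw [h8]; intro h; rw [hcompat _ h t (Or.inl (by ring)), sub_self])
      (by rw [h8]; intro h; rw [hcompat _ h t (Or.inr (by ring)), sub_self])
    exact ⟨v, fun _ => hv⟩
  choose v hv using hex
  have hne0 : ∀ᵐ t : ℝ, t ≠ 0 := by
    simp [ae_iff]
  have hden : ∀ (s : ℂ) (t : ℝ), (s - (c + t * Complex.I)) * (s - (c - t * Complex.I)) =
      (s - c) ^ 2 + (t : ℂ) ^ 2 := fun s t => by rw [sq_add_sq_eq]; ring
  -- For fixed `s` the extension can differ from the original quotient only at `t = 0` and `t = ±Im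
  -- (s - c)`.
  have hae : ∀ s : ℂ, (fun t => (φ s t - ψ s) / ((s - c) ^ 2 + (t : ℂ) ^ 2)) =ᵐ[volume]
      fun t => v t s := by
    intro s
    have h1 : ∀ᵐ t : ℝ, t ≠ (s - c).im := by simp [ae_iff]
    have h2 : ∀ᵐ t : ℝ, t ≠ -(s - c).im := by simp [ae_iff]
    filter_upwards [hne0, h1, h2] with t ht h1 h2
    rw [(hv t ht).2.1 s, hden]
    · intro h; apply h1; rw [h]; simp
    · intro h; apply h2; rw [h]; simp
  have hfun : (fun s => ∫ t : ℝ, (φ s t - ψ s) / ((s - c) ^ 2 + (t : ℂ) ^ 2)) =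
      fun s => ∫ t : ℝ, v t s := funext fun s => integral_congr_ae (hae s)
  rw [hfun]
  have hM0 : 0 ≤ M := (norm_nonneg _).trans (hMψ s₀ (Metric.mem_ball_self hR))
  set D := ‖c - s₀‖ with hD
  refine analyticAt_integral_of_dominated (g := fun s t => v t s) hr0
    (b := fun t => 64 * (2 * M) / (r / (1 + D + r)) ^ 2 / (1 + t ^ 2)) ?_ ?_ ?_
    (integrable_const_div_one_add_sq _)
  · intro s hs
    have hsR : s ∈ Metric.ball s₀ R := Metric.ball_subset_ball (by linarith) hs
    refine AEStronglyMeasurable.congr ?_ (hae s)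
    exact ((hφ s hsR).sub aestronglyMeasurable_const).div₀
      (continuous_sq_add_sq _).aestronglyMeasurable
  · filter_upwards [hne0] with t ht
    exact (hv t ht).1.mono (Metric.ball_subset_ball (by linarith))
  · filter_upwards [hne0] with t ht s hs
    refine ((hv t ht).2.2 s hs).trans ?_
    rw [div_div _ _ (1 + t ^ 2)]
    have ht : ‖(t : ℂ) * Complex.I‖ = |t| := by simp
    refine div_le_div_of_nonneg_left (by positivity) (by positivity) ?_
    refine one_add_sq_le_of_le hr0 (norm_nonneg _) ?_ ?_ ?_ ?_
    · linarith [norm_nonneg (c + t * Complex.I - s₀)]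
    · have := norm_sub_le (c + t * Complex.I - s₀) (c - s₀)
      rw [show c + t * Complex.I - s₀ - (c - s₀) = t * Complex.I by ring, ht] at this
      linarith
    · linarith [norm_nonneg (c - t * Complex.I - s₀)]
    · have := norm_sub_le (c - s₀) (c - t * Complex.I - s₀)
      rw [show c - s₀ - (c - t * Complex.I - s₀) = t * Complex.I by ring, ht] at this
      linarith

/-- Since `Re p > 0`, principal logarithms of `p ± it` give an odd antiderivative. In its limit the
two copies of `log t` cancel and `log i - log (-i) = πi` remains. -/
lemma integral_one_div_sq_add_sq {p : ℂ} (hp : 0 < p.re) :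
    ∫ t : ℝ, 1 / (p ^ 2 + (t : ℂ) ^ 2) = Real.pi / p := by
  have hp0 : p ≠ 0 := by rintro rfl; simp at hp
  have hint : Integrable fun t : ℝ => 1 / (p ^ 2 + (t : ℂ) ^ 2) :=
    integrable_div_sq_add_sq (φ := fun _ => 1) (M := 1) hp.ne' aestronglyMeasurable_const (by simp)
  set A : ℝ → ℂ := fun t => (Complex.log (p + t * Complex.I) - Complex.log (p - t * Complex.I)) /
    (2 * Complex.I * p) with hA
  have hslit1 : ∀ t : ℝ, p + t * Complex.I ∈ Complex.slitPlane := fun t => Or.inl (by simpa using hp)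
  have hslit2 : ∀ t : ℝ, p - t * Complex.I ∈ Complex.slitPlane := fun t => Or.inl (by simpa using hp)
  have hderiv : ∀ t : ℝ, HasDerivAt A (1 / (p ^ 2 + (t : ℂ) ^ 2)) t := by
    intro t
    have k0 : HasDerivAt (fun t : ℝ => (t : ℂ) * Complex.I) Complex.I t := by
      simpa using (Complex.ofRealCLM.hasDerivAt (x := t)).mul_const Complex.I
    have k1 := (k0.const_add p).clog_real (hslit1 t)
    have k2 := (k0.const_sub p).clog_real (hslit2 t)
    refine ((k1.sub k2).div_const (2 * Complex.I * p)).congr_deriv ?_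
    have n1 := Complex.slitPlane_ne_zero (hslit1 t)
    have n2 := Complex.slitPlane_ne_zero (hslit2 t)
    rw [sq_add_sq_eq]
    have := Complex.I_ne_zero
    have e : Complex.I / (p + t * Complex.I) - -Complex.I / (p - t * Complex.I) =
        2 * Complex.I * p / ((p - t * Complex.I) * (p + t * Complex.I)) := by
      rw [div_sub_div _ _ n1 n2, mul_comm (p - t * Complex.I)]
      congr 1
      ring
    rw [e, div_div, mul_comm ((p - t * Complex.I) * _), div_mul_eq_div_div,
      div_self (by simp [hp0])]
  have hodd : ∀ t, A (-t) = -A t := by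
    intro t; simp only [hA]; push_cast; ring_nf
  have htop : Tendsto A atTop (𝓝 (Real.pi / (2 * p))) := by
    have e : ∀ᶠ t : ℝ in atTop, A t = (Complex.log (p / t + Complex.I) -
        Complex.log (p / t - Complex.I)) / (2 * Complex.I * p) := by
      filter_upwards [eventually_gt_atTop 0] with t ht
      have htc : (t : ℂ) ≠ 0 := by exact_mod_cast ht.ne'
      have hre : 0 < (p / t).re := by rw [Complex.div_ofReal_re]; positivity
      have n1 : p / t + Complex.I ≠ 0 := by
        intro h; have := congrArg Complex.re h; simp [-Complex.div_ofReal_re] at this; linarith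
      have n2 : p / t - Complex.I ≠ 0 := by
        intro h; have := congrArg Complex.re h; simp [-Complex.div_ofReal_re] at this; linarith
      have e1 : p + t * Complex.I = t * (p / t + Complex.I) := by field_simp
      have e2 : p - t * Complex.I = t * (p / t - Complex.I) := by field_simp
      simp only [hA]
      rw [e1, e2, Complex.log_ofReal_mul ht n1, Complex.log_ofReal_mul ht n2]
      ring
    refine Tendsto.congr' (EventuallyEq.symm e) ?_
    have h0 : Tendsto (fun t : ℝ => p / (t : ℂ)) atTop (𝓝 0) := by
      rw [tendsto_zero_iff_norm_tendsto_zero]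
      simp only [norm_div, Complex.norm_real]
      exact tendsto_const_nhds.div_atTop tendsto_norm_atTop_atTop
    have l1 : Tendsto (fun t : ℝ => Complex.log (p / t + Complex.I)) atTop
        (𝓝 (Complex.log Complex.I)) := by
      have := h0.add_const Complex.I
      rw [zero_add] at this
      exact this.clog (Or.inr (by simp))
    have l2 : Tendsto (fun t : ℝ => Complex.log (p / t - Complex.I)) atTop
        (𝓝 (Complex.log (-Complex.I))) := by
      have := h0.sub_const Complex.I
      rw [zero_sub] at this
      exact this.clog (Or.inr (by simp))
    have := (l1.sub l2).div_const (2 * Complex.I * p)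
    convert this using 2
    rw [Complex.log_I, Complex.log_neg_I]
    have := Complex.I_ne_zero
    field_simp
    ring
  have hbot : Tendsto A atBot (𝓝 (-(Real.pi / (2 * p)))) := by
    have := (htop.comp tendsto_neg_atBot_atTop).neg
    refine this.congr fun t => ?_
    simp [hodd]
  rw [integral_of_hasDerivAt_of_tendsto hderiv hint hbot htop]
  field_simp
  ring

/-- The integrand is even in `p` while `π / p` is odd. This change of sign across `Re p = 0` is the
source of the residual term. -/
lemma integral_one_div_sq_add_sq_of_neg {p : ℂ} (hp : p.re < 0) :
    ∫ t : ℝ, 1 / (p ^ 2 + (t : ℂ) ^ 2) = -(Real.pi / p) := by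
  have := integral_one_div_sq_add_sq (p := -p) (by simpa using hp)
  rw [neg_sq] at this
  rw [this, div_neg]

lemma integral_sub_div_sq_add_sq {φ : ℝ → ℂ} {z p : ℂ} {M : ℝ} (hp : p.re ≠ 0)
    (hφ : AEStronglyMeasurable φ) (hM : ∀ t, ‖φ t‖ ≤ M) :
    ∫ t : ℝ, (φ t - z) / (p ^ 2 + (t : ℂ) ^ 2) =
      (∫ t : ℝ, φ t / (p ^ 2 + (t : ℂ) ^ 2)) - z * ∫ t : ℝ, 1 / (p ^ 2 + (t : ℂ) ^ 2) := by
  have hint : Integrable fun t : ℝ => 1 / (p ^ 2 + (t : ℂ) ^ 2) :=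
    integrable_div_sq_add_sq (φ := fun _ => 1) (M := 1) hp aestronglyMeasurable_const (by simp)
  rw [← integral_const_mul, ← integral_sub (integrable_div_sq_add_sq hp hφ hM)
    (hint.const_mul _)]
  refine integral_congr_ae (Eventually.of_forall fun t => ?_)
  simp only [sub_div, mul_one_div]

/-! ### The kernel with its polar factors removed -/

/-- The quotient `H(μ) / (Λ(1 + 2μ) Λ(1 - 2μ))`, with the removable singularity at `0` removed. -/
noncomputable def spectralWeight (H : ℂ → ℂ) (μ : ℂ) : ℂ :=
  -4 * μ ^ 2 * H μ / (shiftedZeta (1 + 2 * μ) * shiftedZeta (1 - 2 * μ))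

/-- The integrand of the continuous spectrum with its polar factors removed. -/
noncomputable def regularKernel (α : Fin 3 → ℂ) (H : ℂ → ℂ) (s μ : ℂ) : ℂ :=
  spectralWeight H μ * ∏ j, shiftedZeta (s + μ - α j) * shiftedZeta (s - μ - α j)

lemma spectralWeight_eq {H : ℂ → ℂ} {μ : ℂ} (hμ : μ ≠ 0) :
    spectralWeight H μ =
      H μ / (completedRiemannZeta (1 + 2 * μ) * completedRiemannZeta (1 - 2 * μ)) := by
  have h1 : 1 + 2 * μ ≠ 1 := by simpa using hμ
  have h2 : 1 - 2 * μ ≠ 1 := by simpa using hμ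
  rw [spectralWeight, shiftedZeta_eq h1, shiftedZeta_eq h2,
    ← mul_div_mul_left (H μ) _ (mul_ne_zero (by norm_num : (-4 : ℂ) ≠ 0) (pow_ne_zero 2 hμ))]
  congr 1
  ring

lemma spectralWeight_neg {η : ℝ} {H : ℂ → ℂ} (hH : IsTestFunction η H) {μ : ℂ}
    (hμ : |μ.re| < 2 * η) : spectralWeight H (-μ) = spectralWeight H μ := by
  rw [spectralWeight, spectralWeight, hH.even μ hμ, neg_sq, mul_neg, ← sub_eq_add_neg, sub_neg_eq_add,
    mul_comm (shiftedZeta (1 - 2 * μ))]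

lemma regularKernel_neg {η : ℝ} {α : Fin 3 → ℂ} {H : ℂ → ℂ} (hH : IsTestFunction η H) {s μ : ℂ}
    (hμ : |μ.re| < 2 * η) : regularKernel α H s (-μ) = regularKernel α H s μ := by
  rw [regularKernel, regularKernel, spectralWeight_neg hH hμ]
  congr 1
  refine Finset.prod_congr rfl fun j _ => ?_
  rw [← sub_eq_add_neg, sub_neg_eq_add, mul_comm]

lemma isOpen_abs_re_lt (c : ℝ) : IsOpen {μ : ℂ | |μ.re| < c} :=
  isOpen_lt (by fun_prop) continuous_const

lemma IsTestFunction.analyticAt {η : ℝ} {H : ℂ → ℂ} (hH : IsTestFunction η H) {μ : ℂ}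
    (hμ : |μ.re| < 2 * η) : AnalyticAt ℂ H μ :=
  hH.holomorphic.analyticAt ((isOpen_abs_re_lt _).mem_nhds hμ)

lemma analyticAt_spectralWeight {η : ℝ} (hη : 0 < η) {H : ℂ → ℂ} (hH : IsTestFunction η H) {μ : ℂ}
    (hμ : μ.re = 0) : AnalyticAt ℂ (spectralWeight H) μ := by
  have hHμ := hH.analyticAt (μ := μ) (by rw [hμ, abs_zero]; positivity)
  have n1 : (1 + 2 * μ).re = 1 := by simp [hμ]
  have n2 : (1 - 2 * μ).re = 1 := by simp [hμ]
  have z1 : 1 + 2 * μ ≠ 0 := by intro h; simp [h] at n1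
  have z2 : 1 - 2 * μ ≠ 0 := by intro h; simp [h] at n2
  have a1 : AnalyticAt ℂ (fun μ => shiftedZeta (1 + 2 * μ)) μ :=
    (analyticAt_shiftedZeta z1).fun_comp (f := fun μ => 1 + 2 * μ) (by fun_prop)
  have a2 : AnalyticAt ℂ (fun μ => shiftedZeta (1 - 2 * μ)) μ :=
    (analyticAt_shiftedZeta z2).fun_comp (f := fun μ => 1 - 2 * μ) (by fun_prop)
  unfold spectralWeight
  refine AnalyticAt.div (by fun_prop) (a1.mul a2) ?_
  exact mul_ne_zero (shiftedZeta_ne_zero_of_one_le_re n1.ge) (shiftedZeta_ne_zero_of_one_le_re n2.ge)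

lemma exists_norm_spectralWeight_mul_le {η : ℝ} (hη : 0 < η) {H : ℂ → ℂ}
    (hH : IsTestFunction η H) :
    ∃ C : ℝ, 0 ≤ C ∧ ∀ t : ℝ, ‖spectralWeight H (t * Complex.I)‖ * (1 + |t|) ^ 6 ≤ C := by
  obtain ⟨C₁, hC₁, h1⟩ := exists_sq_div_norm_shiftedZeta_le
  obtain ⟨C₂, h2⟩ := hH.decay
  refine ⟨4 * C₁ * |C₂| * ((14).factorial * Real.exp 1), by positivity, fun t => ?_⟩
  have hHt : ‖H (t * Complex.I)‖ ≤ |C₂| * Real.exp (-(2 * Real.pi * |t|)) := by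
    refine (h2 (t * Complex.I) (by simpa using hη)).trans ?_
    have : ‖(t : ℂ) * Complex.I‖ = |t| := by simp
    rw [this]
    gcongr
    exact le_abs_self _
  have e : ‖spectralWeight H (t * Complex.I)‖ = 4 * (t ^ 2 /
      ‖shiftedZeta (1 + 2 * (t * Complex.I)) * shiftedZeta (1 - 2 * (t * Complex.I))‖) *
        ‖H (t * Complex.I)‖ := by
    rw [spectralWeight, norm_div, norm_mul, norm_mul, norm_pow, norm_mul, Complex.norm_I, norm_neg,
      Complex.norm_ofNat, Complex.norm_real, mul_one, Real.norm_eq_abs, sq_abs]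
    ring
  -- The exponent is `8 + 6`: eight powers from the reciprocal of the denominator and six reserved
  -- for the `shiftedZeta` factors of the kernel. The remaining `e^{-π|t|}` absorbs them because `π
  -- > 1`.
  have hexp : (1 + |t|) ^ 14 * Real.exp (-(Real.pi * |t|)) ≤ (14).factorial * Real.exp 1 := by
    have k := Real.pow_div_factorial_le_exp (1 + |t|) (by positivity) 14
    rw [div_le_iff₀ (by positivity)] at k
    calc _ ≤ Real.exp (1 + |t|) * (14).factorial * Real.exp (-(Real.pi * |t|)) := by gcongr
      _ = (14).factorial * Real.exp (1 + |t| - Real.pi * |t|) := by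
        rw [sub_eq_add_neg (1 + |t|), Real.exp_add (1 + |t|)]; ring
      _ ≤ _ := by
        gcongr
        have := Real.pi_gt_three
        nlinarith [abs_nonneg t]
  rw [e]
  calc _ ≤ 4 * (C₁ * (1 + |t|) ^ 8 * Real.exp (Real.pi * |t|)) *
        (|C₂| * Real.exp (-(2 * Real.pi * |t|))) * (1 + |t|) ^ 6 := by
        gcongr
        exact h1 t
    _ = 4 * C₁ * |C₂| * ((1 + |t|) ^ 14 * Real.exp (-(Real.pi * |t|))) := by
        have : Real.exp (-(Real.pi * |t|)) =
            Real.exp (Real.pi * |t|) * Real.exp (-(2 * Real.pi * |t|)) := by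
          rw [← Real.exp_add]; congr 1; ring
        rw [this]; ring
    _ ≤ _ := by gcongr

/-- On a neighbourhood of a point to the right of all `α j`, the kernel is bounded uniformly on
the line of integration. -/
lemma exists_norm_regularKernel_le {η : ℝ} (hη : 0 < η) {α : Fin 3 → ℂ} {H : ℂ → ℂ}
    (hH : IsTestFunction η H) {s₀ : ℂ} (hs₀ : ∀ j, 0 < (s₀ - α j).re) :
    ∃ R M : ℝ, 0 < R ∧ ∀ s ∈ Metric.ball s₀ R, (∀ j, 0 < (s - α j).re) ∧
      ∀ t : ℝ, ‖regularKernel α H s (t * Complex.I)‖ ≤ M := by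
  obtain ⟨a, ha, ha2⟩ : ∃ a : ℝ, 0 < a ∧ ∀ j, 2 * a ≤ (s₀ - α j).re := by
    refine ⟨(Finset.univ.inf' Finset.univ_nonempty fun j => (s₀ - α j).re) / 2, ?_, fun j => ?_⟩
    · refine half_pos ?_
      rw [Finset.lt_inf'_iff]; exact fun j _ => hs₀ j
    · rw [mul_div_cancel₀ _ two_ne_zero]
      exact Finset.inf'_le _ (Finset.mem_univ j)
  set b : ℝ := ∑ j, ‖s₀ - α j‖ + a with hb
  have hb2 : ∀ j, ‖s₀ - α j‖ + a ≤ b := fun j => by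
    have := Finset.single_le_sum (f := fun j => ‖s₀ - α j‖) (fun j _ => norm_nonneg _)
      (Finset.mem_univ j)
    linarith
  have hb0 : 0 ≤ b := by have := hb2 0; have := norm_nonneg (s₀ - α 0); linarith
  obtain ⟨C, hC, hZ⟩ := exists_norm_shiftedZeta_le (b := b) ha
  obtain ⟨W, hW, hWt⟩ := exists_norm_spectralWeight_mul_le hη hH
  have hre : ∀ s ∈ Metric.ball s₀ a, ∀ j, a ≤ (s - α j).re ∧ (s - α j).re ≤ b ∧
      |(s - α j).im| ≤ b := by
    intro s hs j
    rw [mem_ball_iff_norm] at hs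
    have h1 := Complex.abs_re_le_norm (s - s₀)
    have h2 := ha2 j
    have h3 : ‖s - α j‖ ≤ b := by
      have := norm_add_le (s - s₀) (s₀ - α j)
      rw [sub_add_sub_cancel] at this
      linarith [hb2 j]
    refine ⟨?_, (Complex.re_le_norm _).trans h3, (Complex.abs_im_le_norm _).trans h3⟩
    have e : (s - α j).re = (s₀ - α j).re + (s - s₀).re := by simp
    have := neg_abs_le (s - s₀).re
    linarith
  refine ⟨a, W * (C * (1 + b)) ^ 6, ha, fun s hs => ⟨fun j => ha.trans_le (hre s hs j).1, fun t => ?_⟩⟩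
  have key : ∀ (j : Fin 3) (u : ℝ), |u| = |t| →
      ‖shiftedZeta (s + u * Complex.I - α j)‖ ≤ C * (1 + b) * (1 + |t|) := by
    intro j u hu
    obtain ⟨h1, h2, h3⟩ := hre s hs j
    have er : (s + u * Complex.I - α j).re = (s - α j).re := by simp
    have ei : (s + u * Complex.I - α j).im = (s - α j).im + u := by simp; ring
    refine (hZ _ (by rwa [er]) (by rwa [er])).trans ?_
    rw [mul_assoc]
    gcongr
    rw [ei]
    have := abs_add_le (s - α j).im u
    have := abs_nonneg t
    nlinarith
  have key2 : ∀ j : Fin 3, ‖shiftedZeta (s + t * Complex.I - α j) *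
      shiftedZeta (s - t * Complex.I - α j)‖ ≤ (C * (1 + b) * (1 + |t|)) ^ 2 := by
    intro j
    rw [norm_mul, sq]
    have k1 := key j t rfl
    have k2 := key j (-t) (abs_neg t)
    rw [Complex.ofReal_neg, neg_mul, ← sub_eq_add_neg] at k2
    gcongr
  rw [regularKernel, norm_mul, norm_prod]
  calc _ ≤ ‖spectralWeight H (t * Complex.I)‖ * ∏ j : Fin 3, (C * (1 + b) * (1 + |t|)) ^ 2 := by
        gcongr with j
        exact key2 j
    _ = ‖spectralWeight H (t * Complex.I)‖ * (1 + |t|) ^ 6 * (C * (1 + b)) ^ 6 := by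
        simp only [Finset.prod_const, Finset.card_univ, Fintype.card_fin]; ring
    _ ≤ _ := by gcongr; exact hWt t

lemma continuous_regularKernel {η : ℝ} (hη : 0 < η) {α : Fin 3 → ℂ} {H : ℂ → ℂ}
    (hH : IsTestFunction η H) {s : ℂ} (hs : ∀ j, 0 < (s - α j).re) :
    Continuous fun t : ℝ => regularKernel α H s (t * Complex.I) := by
  have hw : Continuous fun t : ℝ => spectralWeight H (t * Complex.I) := by
    refine continuous_iff_continuousAt.mpr fun t => ?_
    exact ContinuousAt.comp (g := spectralWeight H)
      (analyticAt_spectralWeight hη hH (by simp)).continuousAt (by fun_prop)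
  have hz : ∀ (j : Fin 3) (g : ℝ → ℂ), Continuous g → (∀ t, (g t).re = (s - α j).re) →
      Continuous fun t => shiftedZeta (g t) := by
    intro j g hg hre
    refine continuous_iff_continuousAt.mpr fun t => ?_
    refine ContinuousAt.comp (g := shiftedZeta)
      (differentiableAt_shiftedZeta fun h => ?_).continuousAt hg.continuousAt
    have := hs j
    rw [← hre t, h] at this
    simp at this
  unfold regularKernel
  exact hw.mul (continuous_finsetProd _ fun j _ => (hz j _ (by fun_prop) (by simp)).mul
    (hz j _ (by fun_prop) (by simp)))

lemma differentiableAt_regularKernel {α : Fin 3 → ℂ} {H : ℂ → ℂ} {s : ℂ}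
    (hs : ∀ j, 0 < (s - α j).re) (t : ℝ) :
    DifferentiableAt ℂ (fun s => regularKernel α H s (t * Complex.I)) s := by
  have hz : ∀ (j : Fin 3) (g : ℂ → ℂ), DifferentiableAt ℂ g s → ((g s).re = (s - α j).re) →
      DifferentiableAt ℂ (fun s => shiftedZeta (g s)) s := by
    intro j g hg hre
    refine DifferentiableAt.comp (g := shiftedZeta) s
      (differentiableAt_shiftedZeta fun h => ?_) hg
    have := hs j
    rw [← hre, h] at this
    simp at this
  unfold regularKernel
  refine (differentiableAt_const _).mul (DifferentiableAt.fun_finsetProd fun j _ => ?_)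
  exact (hz j _ (by fun_prop) (by simp)).mul (hz j _ (by fun_prop) (by simp))

/-- The restriction of the kernel to its polar line is holomorphic where that line crosses the
line of integration. -/
lemma analyticAt_regularKernel_pole {η : ℝ} (hη : 0 < η) {α : Fin 3 → ℂ} {H : ℂ → ℂ}
    (hH : IsTestFunction η H) {s : ℂ} (hs : ∀ j, 0 < (s - α j).re) {i : Fin 3}
    (hi : (s - (1 + α i)).re = 0) :
    AnalyticAt ℂ (fun s => regularKernel α H s (s - (1 + α i))) s := by
  have hz : ∀ (j : Fin 3) (g : ℂ → ℂ), AnalyticAt ℂ g s → ((g s).re = (s - α j).re) →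
      AnalyticAt ℂ (fun s => shiftedZeta (g s)) s := by
    intro j g hg hre
    refine (analyticAt_shiftedZeta fun h => ?_).fun_comp hg
    have := hs j
    rw [← hre, h] at this
    simp at this
  unfold regularKernel
  refine AnalyticAt.mul ?_ (Finset.analyticAt_fun_prod _ fun j _ => AnalyticAt.mul
    (hz j _ (by fun_prop) ?_) (hz j _ (by fun_prop) ?_))
  · exact (analyticAt_spectralWeight hη hH hi).fun_comp (f := fun s => s - (1 + α i)) (by fun_prop)
  · simp only [Complex.sub_re, Complex.add_re, Complex.one_re] at *; linarith
  · simp only [Complex.sub_re, Complex.add_re, Complex.one_re] at *; linarith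

/-! ### Convergence and holomorphy of the continuous spectrum -/

lemma contIntegrand_eq {α : Fin 3 → ℂ} {H : ℂ → ℂ} {s : ℂ} (hs : ∀ i, (s - (1 + α i)).re ≠ 0)
    {t : ℝ} (ht : t ≠ 0) :
    contIntegrand α H s (t * Complex.I) = regularKernel α H s (t * Complex.I) /
      ∏ i, ((s - (1 + α i)) ^ 2 + (t : ℂ) ^ 2) := by
  have hμ : (t : ℂ) * Complex.I ≠ 0 := by simpa using ht
  have h1 : ∀ j, s + t * Complex.I - α j ≠ 1 := fun j h => hs j (by
    have := congrArg Complex.re h; simp at this ⊢; linarith)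
  have h2 : ∀ j, s - t * Complex.I - α j ≠ 1 := fun j h => hs j (by
    have := congrArg Complex.re h; simp at this ⊢; linarith)
  have e : ∏ j, shiftedZeta (s + t * Complex.I - α j) * shiftedZeta (s - t * Complex.I - α j) =
      (∏ i, ((s - (1 + α i)) ^ 2 + (t : ℂ) ^ 2)) * ∏ j, completedRiemannZeta (s + t * Complex.I - α j) *
        completedRiemannZeta (s - t * Complex.I - α j) := by
    rw [← Finset.prod_mul_distrib]
    refine Finset.prod_congr rfl fun j _ => ?_
    rw [shiftedZeta_eq (h1 j), shiftedZeta_eq (h2 j), sq_add_sq_eq]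
    ring
  have hne : ∏ i, ((s - (1 + α i)) ^ 2 + (t : ℂ) ^ 2) ≠ 0 :=
    Finset.prod_ne_zero_iff.mpr fun i _ => sq_add_sq_ne_zero (hs i) t
  rw [regularKernel, e, spectralWeight_eq hμ, contIntegrand]
  field_simp

lemma contSpectrum_eq (α : Fin 3 → ℂ) (H : ℂ → ℂ) (s : ℂ) :
    contSpectrum α H s =
      1 / (2 * (Real.pi : ℂ)) * ∫ t : ℝ, contIntegrand α H s (t * Complex.I) := by
  rw [contSpectrum, integral_mul_const]
  have := Complex.I_ne_zero
  have : (Real.pi : ℂ) ≠ 0 := by exact_mod_cast Real.pi_ne_zero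
  field_simp

/-- Index `0` is divided out last, so that the quotient by the other two factors plays the bounded
numerator in the estimates for a single polar factor. The point `t = 0` is excluded because
`completedRiemannZeta` takes a conventional finite value at its pole. -/
lemma contIntegrand_ae_eq {α : Fin 3 → ℂ} {H : ℂ → ℂ} {s : ℂ}
    (hs : ∀ i, (s - (1 + α i)).re ≠ 0) :
    (fun t : ℝ => contIntegrand α H s (t * Complex.I)) =ᵐ[volume] fun t : ℝ =>
      regularKernel α H s (t * Complex.I) / ((s - (1 + α 1)) ^ 2 + (t : ℂ) ^ 2) /
        ((s - (1 + α 2)) ^ 2 + (t : ℂ) ^ 2) / ((s - (1 + α 0)) ^ 2 + (t : ℂ) ^ 2) := by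
  have hne0 : ∀ᵐ t : ℝ, t ≠ 0 := by simp [ae_iff]
  filter_upwards [hne0] with t ht
  rw [contIntegrand_eq hs ht, Fin.prod_univ_three, div_div, div_div]
  congr 1
  ring

lemma sq_le_norm_sq_add_sq {p : ℂ} {δ : ℝ} (hδ : 0 ≤ δ) (hp : δ ≤ |p.re|) (t : ℝ) :
    δ ^ 2 ≤ ‖p ^ 2 + (t : ℂ) ^ 2‖ := by
  rw [sq_add_sq_eq, norm_mul, sq]
  refine mul_le_mul ?_ ?_ hδ (norm_nonneg _)
  · exact hp.trans (by simpa using Complex.abs_re_le_norm (p - t * Complex.I))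
  · exact hp.trans (by simpa using Complex.abs_re_le_norm (p + t * Complex.I))

/-- Near a point off the polar lines, the real parts stay uniformly away from `0`. -/
lemma exists_le_abs_re_sub {c : Fin 3 → ℂ} {s₀ : ℂ} (h : ∀ i, (s₀ - c i).re ≠ 0) :
    ∃ δ : ℝ, 0 < δ ∧ ∀ s ∈ Metric.ball s₀ δ, ∀ i, δ ≤ |(s - c i).re| := by
  obtain ⟨a, ha, ha2⟩ : ∃ a : ℝ, 0 < a ∧ ∀ j, 2 * a ≤ |(s₀ - c j).re| := by
    refine ⟨(Finset.univ.inf' Finset.univ_nonempty fun j => |(s₀ - c j).re|) / 2, ?_, fun j => ?_⟩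
    · refine half_pos ?_
      rw [Finset.lt_inf'_iff]; exact fun j _ => abs_pos.mpr (h j)
    · rw [mul_div_cancel₀ _ two_ne_zero]
      exact Finset.inf'_le _ (Finset.mem_univ j)
  refine ⟨a, ha, fun s hs i => ?_⟩
  rw [mem_ball_iff_norm] at hs
  have h1 := Complex.abs_re_le_norm (s - s₀)
  have e : (s₀ - c i).re = (s - c i).re - (s - s₀).re := by simp
  have h2 := abs_sub (s - c i).re (s - s₀).re
  rw [← e] at h2
  linarith [ha2 i]

lemma norm_div_div_le {x y z : ℂ} {M δ : ℝ} (hδ : 0 < δ) (hx : ‖x‖ ≤ M) (hy : δ ≤ ‖y‖)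
    (hz : δ ≤ ‖z‖) : ‖x / y / z‖ ≤ M / δ / δ := by
  have : 0 ≤ M := (norm_nonneg _).trans hx
  rw [norm_div, norm_div]
  gcongr

lemma integrable_contIntegrand {η : ℝ} (hη : 0 < η) {α : Fin 3 → ℂ} {H : ℂ → ℂ}
    (hH : IsTestFunction η H) {s : ℂ} (hs : ∀ j, 0 < (s - α j).re)
    (hs1 : ∀ i, (s - (1 + α i)).re ≠ 0) :
    Integrable fun t : ℝ => contIntegrand α H s (t * Complex.I) := by
  obtain ⟨R, M, hR, hM⟩ := exists_norm_regularKernel_le hη hH hs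
  obtain ⟨δ, hδ, hδ2⟩ := exists_le_abs_re_sub hs1
  have h0 := hδ2 s (Metric.mem_ball_self hδ)
  refine Integrable.congr (integrable_div_sq_add_sq (M := M / δ ^ 2 / δ ^ 2) (hs1 0) ?_ fun t => ?_)
    (contIntegrand_ae_eq hs1).symm
  · exact (((continuous_regularKernel hη hH hs).div (continuous_sq_add_sq _)
      (sq_add_sq_ne_zero (hs1 1))).div (continuous_sq_add_sq _)
      (sq_add_sq_ne_zero (hs1 2))).aestronglyMeasurable
  · exact norm_div_div_le (by positivity) ((hM s (Metric.mem_ball_self hR)).2 t)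
      (sq_le_norm_sq_add_sq hδ.le (h0 1) t) (sq_le_norm_sq_add_sq hδ.le (h0 2) t)

lemma analyticAt_contSpectrum {η : ℝ} (hη : 0 < η) {α : Fin 3 → ℂ} {H : ℂ → ℂ}
    (hH : IsTestFunction η H) {s₀ : ℂ} (hs : ∀ j, 0 < (s₀ - α j).re)
    (hs1 : ∀ i, (s₀ - (1 + α i)).re ≠ 0) : AnalyticAt ℂ (contSpectrum α H) s₀ := by
  obtain ⟨R, M, hR, hM⟩ := exists_norm_regularKernel_le hη hH hs
  obtain ⟨δ, hδ, hδ2⟩ := exists_le_abs_re_sub hs1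
  have hball : ∀ s ∈ Metric.ball s₀ (min R δ), s ∈ Metric.ball s₀ R ∧ s ∈ Metric.ball s₀ δ :=
    fun s h => ⟨Metric.ball_subset_ball (min_le_left _ _) h,
      Metric.ball_subset_ball (min_le_right _ _) h⟩
  have hne : ∀ s ∈ Metric.ball s₀ (min R δ), ∀ i, (s - (1 + α i)).re ≠ 0 := fun s h i h0 => by
    have := hδ2 s (hball s h).2 i
    rw [h0, abs_zero] at this
    linarith
  have hA := analyticAt_integral_div_sq_add_sq (lt_min hR hδ) (hs1 0) (M := M / δ ^ 2 / δ ^ 2)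
    (φ := fun s t => regularKernel α H s (t * Complex.I) / ((s - (1 + α 1)) ^ 2 + (t : ℂ) ^ 2) /
        ((s - (1 + α 2)) ^ 2 + (t : ℂ) ^ 2)) ?_ ?_ ?_
  · refine (analyticAt_const.mul hA).congr ?_ (f := fun s => 1 / (2 * (Real.pi : ℂ)) * _)
    filter_upwards [Metric.ball_mem_nhds s₀ (lt_min hR hδ)] with s h
    rw [contSpectrum_eq, integral_congr_ae (contIntegrand_ae_eq (hne s h))]
  · intro s h
    have h0 := (hM s (hball s h).1).1
    exact (((continuous_regularKernel hη hH h0).div (continuous_sq_add_sq _)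
      (sq_add_sq_ne_zero (hne s h 1))).div (continuous_sq_add_sq _)
      (sq_add_sq_ne_zero (hne s h 2))).aestronglyMeasurable
  · intro t s h
    have h0 := (hM s (hball s h).1).1
    have hd := differentiableAt_regularKernel (H := H) h0 t
    exact ((hd.fun_div (by fun_prop) (sq_add_sq_ne_zero (hne s h 1) t)).fun_div (by fun_prop)
      (sq_add_sq_ne_zero (hne s h 2) t)).differentiableWithinAt
  · intro s h t
    exact norm_div_div_le (by positivity) ((hM s (hball s h).1).2 t)
      (sq_le_norm_sq_add_sq hδ.le (hδ2 s (hball s h).2 1) t)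
      (sq_le_norm_sq_add_sq hδ.le (hδ2 s (hball s h).2 2) t)

/-! ### Partial fractions and the residual term -/

/-- The `i`-th summand of the residual term. -/
noncomputable def residualSummand (α : Fin 3 → ℂ) (H : ℂ → ℂ) (i : Fin 3) (s : ℂ) : ℂ :=
  2 * (H (1 - s + α i) * (∏ j ∈ Finset.univ.erase i,
      completedRiemannZeta (1 + α i - α j) * completedRiemannZeta (2 * s - 1 - α i - α j)) /
    completedRiemannZeta (3 - 2 * s + 2 * α i))

lemma residualTerm_eq_sum (α : Fin 3 → ℂ) (H : ℂ → ℂ) (s : ℂ) :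
    residualTerm α H s = ∑ i, residualSummand α H i s := by
  rw [residualTerm, Finset.mul_sum]
  rfl

/-- The coefficients of the partial fraction expansion of `∏ i, ((s - 1 - α i)² + x)⁻¹`. -/
noncomputable def partialFractionCoeff (α : Fin 3 → ℂ) (i : Fin 3) (s : ℂ) : ℂ :=
  ∏ j ∈ Finset.univ.erase i, ((s - (1 + α j)) ^ 2 - (s - (1 + α i)) ^ 2)⁻¹

/-- The integral of the kernel against a single polar factor. -/
noncomputable def polarIntegral (α : Fin 3 → ℂ) (H : ℂ → ℂ) (i : Fin 3) (s : ℂ) : ℂ :=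
  ∫ t : ℝ, regularKernel α H s (t * Complex.I) / ((s - (1 + α i)) ^ 2 + (t : ℂ) ^ 2)

/-- The regularization of `polarIntegral`, holomorphic across its polar line. -/
noncomputable def regularPolarIntegral (α : Fin 3 → ℂ) (H : ℂ → ℂ) (i : Fin 3) (s : ℂ) : ℂ :=
  ∫ t : ℝ, (regularKernel α H s (t * Complex.I) - regularKernel α H s (s - (1 + α i))) /
    ((s - (1 + α i)) ^ 2 + (t : ℂ) ^ 2)

/-- The continuation of the contribution of the `i`-th polar factor to the continuous spectrum. -/
noncomputable def crossTerm (α : Fin 3 → ℂ) (H : ℂ → ℂ) (i : Fin 3) (s : ℂ) : ℂ :=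
  if 0 < (s - (1 + α i)).re then
    partialFractionCoeff α i s / (2 * Real.pi) * polarIntegral α H i s
  else if (s - (1 + α i)).re < 0 then
    partialFractionCoeff α i s / (2 * Real.pi) * polarIntegral α H i s + residualSummand α H i s
  else partialFractionCoeff α i s / (2 * Real.pi) * regularPolarIntegral α H i s +
    residualSummand α H i s / 2

/-- The quadratic terms in `s` cancel, so for `α i ≠ α j` the partial fraction denominator has a
single zero. -/
lemma sq_sub_sq_pole (α : Fin 3 → ℂ) (i j : Fin 3) (s : ℂ) :
    (s - (1 + α j)) ^ 2 - (s - (1 + α i)) ^ 2 =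
      (α i - α j) * (2 * (s - (1 + (α i + α j) / 2))) := by
  ring

lemma eventually_nhdsNE_ne (z s₀ : ℂ) : ∀ᶠ s in 𝓝[≠] s₀, s ≠ z := by
  by_cases h : z = s₀
  · rw [h]; exact self_mem_nhdsWithin
  · exact nhdsWithin_le_nhds (isOpen_ne.mem_nhds (Ne.symm h))

/-- Off a discrete set the points `s - 1 - α i` have distinct nonzero squares. -/
lemma eventually_sq_sub_sq_ne_zero {α : Fin 3 → ℂ} (hα : Function.Injective α) (s₀ : ℂ) :
    ∀ᶠ s in 𝓝[≠] s₀, ∀ i j, j ≠ i → (s - (1 + α j)) ^ 2 - (s - (1 + α i)) ^ 2 ≠ 0 := by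
  rw [eventually_all]; intro i
  rw [eventually_all]; intro j
  filter_upwards [eventually_nhdsNE_ne (1 + (α i + α j) / 2) s₀] with s hs hij
  rw [sq_sub_sq_pole]
  exact mul_ne_zero (sub_ne_zero.mpr fun h => hij (hα h.symm))
    (mul_ne_zero two_ne_zero (sub_ne_zero.mpr hs))

lemma contSpectrum_eq_sum {η : ℝ} (hη : 0 < η) {α : Fin 3 → ℂ} {H : ℂ → ℂ}
    (hH : IsTestFunction η H) {s : ℂ} (hs : ∀ j, 0 < (s - α j).re)
    (hs1 : ∀ i, (s - (1 + α i)).re ≠ 0)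
    (hgen : ∀ i j, j ≠ i → (s - (1 + α j)) ^ 2 - (s - (1 + α i)) ^ 2 ≠ 0) :
    contSpectrum α H s =
      ∑ i, partialFractionCoeff α i s / (2 * Real.pi) * polarIntegral α H i s := by
  obtain ⟨R, M, hR, hM⟩ := exists_norm_regularKernel_le hη hH hs
  have hint : ∀ i, Integrable fun t : ℝ =>
      regularKernel α H s (t * Complex.I) / ((s - (1 + α i)) ^ 2 + (t : ℂ) ^ 2) := fun i =>
    integrable_div_sq_add_sq (hs1 i) (continuous_regularKernel hη hH hs).aestronglyMeasurable
      (hM s (Metric.mem_ball_self hR)).2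
  rw [contSpectrum_eq, integral_congr_ae (contIntegrand_ae_eq hs1)]
  have e : ∀ t : ℝ, regularKernel α H s (t * Complex.I) / ((s - (1 + α 1)) ^ 2 + (t : ℂ) ^ 2) /
        ((s - (1 + α 2)) ^ 2 + (t : ℂ) ^ 2) / ((s - (1 + α 0)) ^ 2 + (t : ℂ) ^ 2) =
      ∑ i, partialFractionCoeff α i s *
        (regularKernel α H s (t * Complex.I) / ((s - (1 + α i)) ^ 2 + (t : ℂ) ^ 2)) := by
    intro t
    have n0 := sq_add_sq_ne_zero (hs1 0) t
    have n1 := sq_add_sq_ne_zero (hs1 1) t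
    have n2 := sq_add_sq_ne_zero (hs1 2) t
    have g01 := hgen 0 1 (by decide)
    have g02 := hgen 0 2 (by decide)
    have g10 := hgen 1 0 (by decide)
    have g12 := hgen 1 2 (by decide)
    have g20 := hgen 2 0 (by decide)
    have g21 := hgen 2 1 (by decide)
    have c0 : partialFractionCoeff α 0 s = ((s - (1 + α 1)) ^ 2 - (s - (1 + α 0)) ^ 2)⁻¹ *
        ((s - (1 + α 2)) ^ 2 - (s - (1 + α 0)) ^ 2)⁻¹ := by
      rw [partialFractionCoeff, show (Finset.univ.erase 0 : Finset (Fin 3)) = {1, 2} by decide,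
        Finset.prod_pair (by decide)]
    have c1 : partialFractionCoeff α 1 s = ((s - (1 + α 0)) ^ 2 - (s - (1 + α 1)) ^ 2)⁻¹ *
        ((s - (1 + α 2)) ^ 2 - (s - (1 + α 1)) ^ 2)⁻¹ := by
      rw [partialFractionCoeff, show (Finset.univ.erase 1 : Finset (Fin 3)) = {0, 2} by decide,
        Finset.prod_pair (by decide)]
    have c2 : partialFractionCoeff α 2 s = ((s - (1 + α 0)) ^ 2 - (s - (1 + α 2)) ^ 2)⁻¹ *
        ((s - (1 + α 1)) ^ 2 - (s - (1 + α 2)) ^ 2)⁻¹ := by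
      rw [partialFractionCoeff, show (Finset.univ.erase 2 : Finset (Fin 3)) = {0, 1} by decide,
        Finset.prod_pair (by decide)]
    rw [Fin.sum_univ_three, c0, c1, c2]
    generalize (s - (1 + α 0)) ^ 2 = q0 at *
    generalize (s - (1 + α 1)) ^ 2 = q1 at *
    generalize (s - (1 + α 2)) ^ 2 = q2 at *
    have e10 : (q0 - q1) = -(q1 - q0) := by ring
    have e20 : (q0 - q2) = -(q2 - q0) := by ring
    have e21 : (q1 - q2) = -(q2 - q1) := by ring
    rw [e10, e20, e21]
    field_simp
    ring
  simp_rw [e]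
  rw [integral_finsetSum _ fun i _ => (hint i).const_mul _, Finset.mul_sum]
  refine Finset.sum_congr rfl fun i _ => ?_
  rw [integral_const_mul, polarIntegral]
  ring

/-- The residue of the kernel at its pole is the summand of the residual term. -/
lemma residualSummand_eq {η : ℝ} {α : Fin 3 → ℂ} {H : ℂ → ℂ}
    (hH : IsTestFunction η H) {i : Fin 3} {s : ℂ} (hre : |(s - (1 + α i)).re| < 2 * η)
    (hp : s - (1 + α i) ≠ 0) (hz : shiftedZeta (1 + 2 * (s - (1 + α i))) ≠ 0)
    (hgen : ∀ i j, j ≠ i → (s - (1 + α j)) ^ 2 - (s - (1 + α i)) ^ 2 ≠ 0) :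
    residualSummand α H i s = partialFractionCoeff α i s *
      regularKernel α H s (s - (1 + α i)) / (s - (1 + α i)) := by
  set p := s - (1 + α i) with hpdef
  have a1 : H (1 - s + α i) = H p := by
    rw [← hH.even p hre]; congr 1; rw [hpdef]; ring
  have a2 : 3 - 2 * s + 2 * α i = 1 - 2 * p := by rw [hpdef]; ring
  -- The numerator factors of index `i` are `shiftedZeta (1 + 2 * p)` and `shiftedZeta 1 = 1`. The
  -- first cancels against the weight; the factor `p` left over cancels the `1 / p` of the residue.
  have hw : spectralWeight H p * shiftedZeta (1 + 2 * p) =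
      2 * p * (H p / completedRiemannZeta (1 - 2 * p)) := by
    have h2 : 1 - 2 * p ≠ 1 := by simpa using hp
    rw [spectralWeight, shiftedZeta_eq h2,
      ← mul_div_mul_left (H p) _ (mul_ne_zero (by norm_num : (-2 : ℂ) ≠ 0) hp),
      show (1 - 2 * p - 1) * completedRiemannZeta (1 - 2 * p) =
        -2 * p * completedRiemannZeta (1 - 2 * p) by ring]
    rw [mul_comm (shiftedZeta (1 + 2 * p)), div_mul_eq_div_div, div_mul_cancel₀ _ hz, mul_div_assoc']
    congr 1
    ring
  have hprod : (∏ j, shiftedZeta (s + p - α j) * shiftedZeta (s - p - α j)) =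
      shiftedZeta (1 + 2 * p) * ∏ j ∈ Finset.univ.erase i,
        shiftedZeta (s + p - α j) * shiftedZeta (s - p - α j) := by
    rw [← Finset.mul_prod_erase _ _ (Finset.mem_univ i)]
    have e1 : s + p - α i = 1 + 2 * p := by rw [hpdef]; ring
    have e2 : s - p - α i = 1 := by rw [hpdef]; ring
    rw [e1, e2, shiftedZeta_one, mul_one]
  -- For `j ≠ i` the difference of squares is exactly the product of the two factors `z - 1`
  -- inserted into `Λ`, so the partial fraction coefficient restores the original zeta values.
  have hterm : ∀ j ∈ Finset.univ.erase i, ((s - (1 + α j)) ^ 2 - p ^ 2)⁻¹ *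
      (shiftedZeta (s + p - α j) * shiftedZeta (s - p - α j)) =
      completedRiemannZeta (1 + α i - α j) * completedRiemannZeta (2 * s - 1 - α i - α j) := by
    intro j hj
    have hji := Finset.ne_of_mem_erase hj
    have hg := hgen i j hji
    rw [← hpdef] at hg
    have e1 : s + p - α j = 2 * s - 1 - α i - α j := by rw [hpdef]; ring
    have e2 : s - p - α j = 1 + α i - α j := by rw [hpdef]; ring
    have ef : (s - (1 + α j)) ^ 2 - p ^ 2 =
        (1 + α i - α j - 1) * (2 * s - 1 - α i - α j - 1) := by rw [hpdef]; ring
    rw [ef] at hg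
    have n1 := left_ne_zero_of_mul hg
    have n2 := right_ne_zero_of_mul hg
    rw [e1, e2, shiftedZeta_eq (sub_ne_zero.mp n1), shiftedZeta_eq (sub_ne_zero.mp n2), ef,
      inv_mul_eq_iff_eq_mul₀ hg]
    ring
  have hcombine : partialFractionCoeff α i s * ∏ j ∈ Finset.univ.erase i,
      shiftedZeta (s + p - α j) * shiftedZeta (s - p - α j) = ∏ j ∈ Finset.univ.erase i,
      completedRiemannZeta (1 + α i - α j) * completedRiemannZeta (2 * s - 1 - α i - α j) := by
    rw [partialFractionCoeff, ← Finset.prod_mul_distrib]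
    exact Finset.prod_congr rfl hterm
  rw [residualSummand, ← hcombine, a1, a2, regularKernel, hprod, ← mul_assoc (spectralWeight H p), hw]
  field_simp

/-! ### Meromorphy across the polar lines -/

lemma meromorphicAt_partialFractionCoeff (α : Fin 3 → ℂ) (i : Fin 3) (s₀ : ℂ) :
    MeromorphicAt (partialFractionCoeff α i) s₀ := by
  have : partialFractionCoeff α i = ∏ j ∈ Finset.univ.erase i,
      fun s => ((s - (1 + α j)) ^ 2 - (s - (1 + α i)) ^ 2)⁻¹ := by
    ext s; simp [partialFractionCoeff]
  rw [this]
  exact MeromorphicAt.prod fun j _ => by fun_prop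

lemma meromorphicAt_residualSummand {η : ℝ} {α : Fin 3 → ℂ} {H : ℂ → ℂ}
    (hH : IsTestFunction η H) {i : Fin 3} {s₀ : ℂ} (hs₀ : |(1 - s₀ + α i).re| < 2 * η) :
    MeromorphicAt (residualSummand α H i) s₀ := by
  have hHa : AnalyticAt ℂ (fun s => H (1 - s + α i)) s₀ :=
    (hH.analyticAt hs₀).fun_comp (f := fun s => 1 - s + α i) (by fun_prop)
  have hz : ∀ a b : ℂ, a ≠ 0 → MeromorphicAt (fun s => completedRiemannZeta (a * s + b)) s₀ := by
    intro a b ha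
    refine (meromorphicAt_completedRiemannZeta _).comp_analyticAt (g := fun s => a * s + b) ?_
    fun_prop
  have h1 : MeromorphicAt (fun s => ∏ j ∈ Finset.univ.erase i,
      completedRiemannZeta (1 + α i - α j) * completedRiemannZeta (2 * s + (-1 - α i - α j))) s₀ :=
    MeromorphicAt.fun_prod fun j _ => (MeromorphicAt.const _ _).fun_mul (hz _ _ two_ne_zero)
  have h2 := hz (-2) (3 + 2 * α i) (by norm_num)
  have e : residualSummand α H i = fun s => 2 * (H (1 - s + α i) * (∏ j ∈ Finset.univ.erase i,
      completedRiemannZeta (1 + α i - α j) *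
        completedRiemannZeta (2 * s + (-1 - α i - α j))) /
      completedRiemannZeta (-2 * s + (3 + 2 * α i))) := by
    ext s
    simp only [residualSummand,
      show ∀ j, 2 * s + (-1 - α i - α j) = 2 * s - 1 - α i - α j from fun j => by ring,
      show -2 * s + (3 + 2 * α i) = 3 - 2 * s + 2 * α i by ring]
  rw [e]
  exact (MeromorphicAt.const _ _).fun_mul ((hHa.meromorphicAt.fun_mul h1).fun_div h2)

lemma analyticAt_polarIntegral {η : ℝ} (hη : 0 < η) {α : Fin 3 → ℂ} {H : ℂ → ℂ}
    (hH : IsTestFunction η H) {s₀ : ℂ} (hs : ∀ j, 0 < (s₀ - α j).re) {i : Fin 3}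
    (hi : (s₀ - (1 + α i)).re ≠ 0) : AnalyticAt ℂ (polarIntegral α H i) s₀ := by
  obtain ⟨R, M, hR, hM⟩ := exists_norm_regularKernel_le hη hH hs
  exact analyticAt_integral_div_sq_add_sq hR hi
    (fun s h => (continuous_regularKernel hη hH (hM s h).1).aestronglyMeasurable)
    (fun t s h => (differentiableAt_regularKernel (hM s h).1 t).differentiableWithinAt)
    (fun s h => (hM s h).2)

/-- The subtracted value matches the kernel at both `it = p` and `it = -p` because the kernel is
even in `μ`. -/
lemma analyticAt_regularPolarIntegral {η : ℝ} (hη : 0 < η) {α : Fin 3 → ℂ} {H : ℂ → ℂ}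
    (hH : IsTestFunction η H) {s₀ : ℂ} (hs : ∀ j, 0 < (s₀ - α j).re) {i : Fin 3}
    (hi : (s₀ - (1 + α i)).re = 0) : AnalyticAt ℂ (regularPolarIntegral α H i) s₀ := by
  obtain ⟨R, M, hR, hM⟩ := exists_norm_regularKernel_le hη hH hs
  have hψ := analyticAt_regularKernel_pole hη hH hs hi
  have hbdd : ∀ᶠ s in 𝓝 s₀, ‖regularKernel α H s (s - (1 + α i))‖ <
      ‖regularKernel α H s₀ (s₀ - (1 + α i))‖ + 1 :=
    hψ.continuousAt.norm.eventually (gt_mem_nhds (lt_add_one _))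
  obtain ⟨r, hr, hball⟩ := Metric.eventually_nhds_iff_ball.mp
    ((hψ.eventually_analyticAt.and hbdd).and (Metric.ball_mem_nhds s₀ hR))
  set K := max M (‖regularKernel α H s₀ (s₀ - (1 + α i))‖ + 1)
  refine analyticAt_integral_sub_div_sq_add_sq (M := K) (R := r) hr
    (φ := fun s t => regularKernel α H s (t * Complex.I))
    (ψ := fun s => regularKernel α H s (s - (1 + α i))) ?_ ?_ ?_ ?_ ?_ ?_
  · exact fun s h =>
      (continuous_regularKernel hη hH (hM s (hball s h).2).1).aestronglyMeasurable
  · exact fun t s h =>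
      (differentiableAt_regularKernel (hM s (hball s h).2).1 t).differentiableWithinAt
  · exact fun s h t => ((hM s (hball s h).2).2 t).trans (le_max_left _ _)
  · exact fun s h => (hball s h).1.1.differentiableAt.differentiableWithinAt
  · exact fun s h => (hball s h).1.2.le.trans (le_max_right _ _)
  · rintro s - t (h | h)
    · simp only [h]
    · simp only [h]
      exact (regularKernel_neg hH (by simpa using hη)).symm

lemma regularPolarIntegral_eq {η : ℝ} (hη : 0 < η) {α : Fin 3 → ℂ} {H : ℂ → ℂ}
    (hH : IsTestFunction η H) {s : ℂ} (hs : ∀ j, 0 < (s - α j).re) {i : Fin 3}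
    (hi : (s - (1 + α i)).re ≠ 0) :
    regularPolarIntegral α H i s = polarIntegral α H i s -
      regularKernel α H s (s - (1 + α i)) *
        ∫ t : ℝ, 1 / ((s - (1 + α i)) ^ 2 + (t : ℂ) ^ 2) := by
  obtain ⟨R, M, hR, hM⟩ := exists_norm_regularKernel_le hη hH hs
  exact integral_sub_div_sq_add_sq hi (continuous_regularKernel hη hH hs).aestronglyMeasurable
    (hM s (Metric.mem_ball_self hR)).2

/-- Near the polar line, off a discrete set, all three cases of `crossTerm` equal one meromorphic
expression: the coefficient times the regularized integral plus `π K(s, p_i) / p_i`. On the right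
this is the polar integral; on the left it exceeds the polar integral by `2π K(s, p_i) / p_i`, and
on the line itself half a residue accounts for it. -/
lemma meromorphicAt_crossTerm {η : ℝ} (hη : 1 < η) {α : Fin 3 → ℂ} (hα : Function.Injective α)
    {H : ℂ → ℂ} (hH : IsTestFunction η H) {s₀ : ℂ} (hs : ∀ j, 0 < (s₀ - α j).re) (i : Fin 3) :
    MeromorphicAt (crossTerm α H i) s₀ := by
  have hη0 : 0 < η := by linarith
  have hd : MeromorphicAt (fun s => partialFractionCoeff α i s / (2 * Real.pi)) s₀ :=
    (meromorphicAt_partialFractionCoeff α i s₀).fun_div (MeromorphicAt.const _ _)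
  have hcont : Continuous fun s : ℂ => (s - (1 + α i)).re := by fun_prop
  have hR : (s₀ - (1 + α i)).re ≤ 0 → MeromorphicAt (residualSummand α H i) s₀ := by
    intro h
    refine meromorphicAt_residualSummand hH ?_
    -- Here `Re (s₀ - α i)` lies in `(0, 1]`, so the argument of `H` has real part in `[0, 1)`,
    -- inside the strip of holomorphy.
    have := hs i
    simp only [Complex.sub_re, Complex.add_re, Complex.one_re] at *
    rw [abs_lt]
    constructor <;> linarith
  rcases lt_trichotomy (s₀ - (1 + α i)).re 0 with h | h | h
  · refine ((hd.fun_mul (analyticAt_polarIntegral hη0 hH hs h.ne).meromorphicAt).fun_add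
      (hR h.le)).congr ?_
    refine EventuallyEq.filter_mono ?_ nhdsWithin_le_nhds
    filter_upwards [hcont.continuousAt.eventually (gt_mem_nhds h)] with s hlt
    rw [crossTerm, if_neg hlt.not_gt, if_pos hlt]
  · have hψ := analyticAt_regularKernel_pole hη0 hH hs h
    have hm : MeromorphicAt (fun s => partialFractionCoeff α i s / (2 * Real.pi) *
        (regularPolarIntegral α H i s + Real.pi / (s - (1 + α i)) *
          regularKernel α H s (s - (1 + α i)))) s₀ := by
      refine hd.fun_mul ((analyticAt_regularPolarIntegral hη0 hH hs h).meromorphicAt.fun_add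
        (MeromorphicAt.fun_mul ?_ hψ.meromorphicAt))
      fun_prop
    refine hm.congr ?_
    have hz : ∀ᶠ s in 𝓝 s₀, shiftedZeta (1 + 2 * (s - (1 + α i))) ≠ 0 := by
      have hre : (1 + 2 * (s₀ - (1 + α i))).re = 1 := by
        rw [Complex.add_re, Complex.mul_re, h]; simp
      have hne : 1 + 2 * (s₀ - (1 + α i)) ≠ 0 := fun h0 => by simp [h0] at hre
      have : ContinuousAt (fun s => shiftedZeta (1 + 2 * (s - (1 + α i)))) s₀ :=
        ContinuousAt.comp (g := shiftedZeta) (f := fun s => 1 + 2 * (s - (1 + α i)))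
          (differentiableAt_shiftedZeta hne).continuousAt (by fun_prop)
      exact this.eventually_ne (shiftedZeta_ne_zero_of_one_le_re hre.ge)
    have hsmall : ∀ᶠ s in 𝓝 s₀, |(s - (1 + α i)).re| < 2 * η :=
      hcont.abs.continuousAt.eventually (gt_mem_nhds (by simp only [h, abs_zero]; linarith))
    have hpos : ∀ᶠ s in 𝓝 s₀, ∀ j, 0 < (s - α j).re := by
      rw [eventually_all]
      intro j
      exact (by fun_prop : Continuous fun s : ℂ => (s - α j).re).continuousAt.eventually
        (lt_mem_nhds (hs j))
    filter_upwards [nhdsWithin_le_nhds hz, nhdsWithin_le_nhds hsmall, nhdsWithin_le_nhds hpos,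
      eventually_sq_sub_sq_ne_zero hα s₀, eventually_nhdsNE_ne (1 + α i) s₀] with s k1 k2 k3 k4 k5
    have hp := sub_ne_zero.mpr k5
    have hres := residualSummand_eq hH k2 hp k1 k4
    have hπ : (Real.pi : ℂ) ≠ 0 := by exact_mod_cast Real.pi_ne_zero
    rw [crossTerm]
    split_ifs with c1 c2
    · rw [regularPolarIntegral_eq hη0 hH k3 c1.ne', integral_one_div_sq_add_sq c1]
      ring
    · rw [regularPolarIntegral_eq hη0 hH k3 c2.ne, integral_one_div_sq_add_sq_of_neg c2, hres]
      field_simp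
      ring
    · rw [hres]
      field_simp
  · refine (hd.fun_mul (analyticAt_polarIntegral hη0 hH hs h.ne').meromorphicAt).congr ?_
    refine EventuallyEq.filter_mono ?_ nhdsWithin_le_nhds
    filter_upwards [hcont.continuousAt.eventually (lt_mem_nhds h)] with s hlt
    rw [crossTerm, if_pos hlt]

/-! ### The continuation to Re s > ε -/

theorem mainTheorem7 (ε : ℝ) (hε : ε = 1 / 100) (η : ℝ) (hη : 40 < η)
    (α : Fin 3 → ℂ) (hα_distinct : Function.Injective α) (hα_sum : α 0 + α 1 + α 2 = 0)
    (hα_zero : ‖α 0‖ < ε / 1000) (hα_one : ‖α 1‖ < ε / 1000)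
    (H : ℂ → ℂ) (hH : IsTestFunction η H) :
    (∀ s : ℂ, ((∀ i, 1 + (α i).re < s.re) ∨ (ε < s.re ∧ s.re < 1 - ε)) →
      MeasureTheory.Integrable (fun t : ℝ => contIntegrand α H s ((t : ℂ) * Complex.I))) ∧
    ∃ F : ℂ → ℂ,
      IsMeromorphicContinuation (contSpectrum α H) {s : ℂ | ∀ i, 1 + (α i).re < s.re}
        F {s : ℂ | ε < s.re} ∧
      ∀ s : ℂ, ε < s.re → s.re < 1 - ε → (∀ k, s ≠ (1 - α k) / 2) →
        F s = residualTerm α H s + contSpectrum α H s := by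
  have hη1 : 1 < η := by linarith
  have hη0 : 0 < η := by linarith
  have hre : ∀ i, |(α i).re| < ε := by
    have h2 : ‖α 2‖ ≤ ‖α 0‖ + ‖α 1‖ := by
      rw [show α 2 = -(α 0 + α 1) by linear_combination hα_sum, norm_neg]
      exact norm_add_le _ _
    intro i
    refine (Complex.abs_re_le_norm _).trans_lt ?_
    fin_cases i <;> simp only [Fin.zero_eta, Fin.mk_one, Fin.reduceFinMk] <;> linarith
  have hpos : ∀ s : ℂ, ε < s.re → ∀ j, 0 < (s - α j).re := fun s hs j => by
    have := (abs_lt.mp (hre j)).2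
    rw [Complex.sub_re]; linarith
  have hright : ∀ s : ℂ, (∀ i, 1 + (α i).re < s.re) →
      ε < s.re ∧ ∀ i, 0 < (s - (1 + α i)).re := fun s hs => by
    refine ⟨?_, fun i => by simpa using hs i⟩
    have := (abs_lt.mp (hre 0)).1
    have := hs 0
    linarith
  have hleft : ∀ s : ℂ, s.re < 1 - ε → ∀ i, (s - (1 + α i)).re < 0 := fun s hs i => by
    have := (abs_lt.mp (hre i)).1
    rw [Complex.sub_re, Complex.add_re, Complex.one_re]; linarith
  have hVopen : IsOpen {s : ℂ | ∀ i, 1 + (α i).re < s.re} := by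
    simp only [Set.ofPred_forall]
    exact isOpen_iInter_of_finite fun i => isOpen_lt continuous_const Complex.continuous_re
  classical
  -- The partial fraction identity fails at isolated points, so `∑ i, crossTerm α H i s` alone need
  -- not have the required values there. Prescribing these values on the half-plane and on the strip
  -- makes both identities hold at every point; meromorphy depends only on punctured neighbourhoods,
  -- where the sum still describes the function.
  refine ⟨?_, fun s => if ∀ i, 1 + (α i).re < s.re then contSpectrum α H s else
    if s.re < 1 - ε then residualTerm α H s + contSpectrum α H s else ∑ i, crossTerm α H i s,
    ⟨hVopen, ⟨2, fun i => ?_⟩, isOpen_lt continuous_const Complex.continuous_re,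
      (convex_halfSpace_re_gt ε).isPreconnected, fun s hs => (hright s hs).1, ?_, ?_, ?_⟩, ?_⟩
  · rintro s (hs | ⟨h1, h2⟩)
    · exact integrable_contIntegrand hη0 hH (hpos s (hright s hs).1)
        fun i => ((hright s hs).2 i).ne'
    · exact integrable_contIntegrand hη0 hH (hpos s h1) fun i => (hleft s h2 i).ne
  · have := (abs_lt.mp (hre i)).2
    rw [Complex.re_ofNat]
    linarith
  · exact fun s hs => (analyticAt_contSpectrum hη0 hH (hpos s (hright s hs).1)
      fun i => ((hright s hs).2 i).ne').differentiableAt.differentiableWithinAt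
  · intro s₀ hs₀
    have hm : MeromorphicAt (fun s => ∑ i, crossTerm α H i s) s₀ :=
      MeromorphicAt.fun_sum fun i _ =>
        meromorphicAt_crossTerm hη1 hα_distinct hH (hpos s₀ hs₀) i
    refine hm.congr ?_
    have hnear : ∀ᶠ s in 𝓝 s₀, ε < s.re :=
      Complex.continuous_re.continuousAt.eventually (lt_mem_nhds hs₀)
    filter_upwards [nhdsWithin_le_nhds hnear, eventually_sq_sub_sq_ne_zero hα_distinct s₀]
      with s hs hgen
    split_ifs with c1 c2
    · rw [contSpectrum_eq_sum hη0 hH (hpos s hs) (fun i => ((hright s c1).2 i).ne') hgen]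
      exact Finset.sum_congr rfl fun i _ => by rw [crossTerm, if_pos ((hright s c1).2 i)]
    · rw [contSpectrum_eq_sum hη0 hH (hpos s hs) (fun i => (hleft s c2 i).ne) hgen,
        residualTerm_eq_sum, add_comm, ← Finset.sum_add_distrib]
      exact Finset.sum_congr rfl fun i _ => by
        rw [crossTerm, if_neg (hleft s c2 i).not_gt, if_pos (hleft s c2 i)]
    · rfl
  · exact fun s hs => if_pos hs
  · intro s _ h2 _
    have hV : ¬ ∀ i, 1 + (α i).re < s.re := fun h =>
      ((hright s h).2 0).not_gt (hleft s h2 0)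
    simp only [if_neg hV, if_pos h2]
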